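/- **Setting.** Let $d\ge 1$. A configuration is a locally finite set $\omega\subset\mathbb R^d$; the space $\Omega$ of configurations carries the $\sigma$-algebra generated by the counting variables $N_\Lambda(\omega)=\#(\omega\cap\Lambda)$. Throughout, $\Lambda,\Lambda'$ denote bounded Borel sets, $\omega_\Lambda=\omega\cap\Lambda$, $\omega\cup x=\omega\cup\{x\}$, and $\tau_u$ is translation by $u$. A *family of energies* is a family of measurable functions $H_\Lambda:\Omega\to\mathbb R\cup\{+\infty\}$ such that for all $\Lambda\subset\Lambda'$ there is a measurable $\varphi_{\Lambda,\Lambda'}:\Omega\to\mathbb R\cup\{+\infty\}$ with $H_{\Lambda'}(\omega)=H_\Lambda(\omega)+\varphi_{\Lambda,\Lambda'}(\omega_{\Lambda^c})$ for all $\omega$. Let $\Omega_\infty$ be the set of $\omega$ with $H_\Lambda(\omega)<\infty$ for all $\Lambda$. The family is *integrable* (for a given $z>0$) if $0<\int e^{-H_\Lambda(\omega'_\Lambda\cup\omega_{\Lambda^c})}\pi^z_\Lambda(d\omega')<\infty$ for all $\Lambda$ of positive Lebesgue measure and all $\omega\in\Omega_\infty$, where $\pi^z_\Lambda$ is the Poisson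 process of intensity $z$ in $\Lambda$. It is *shift-invariant* if $H_\Lambda(\omega)=H_{\tau_u\Lambda}(\tau_u\omega)$ for all $u,\omega,\Lambda$. The family is *differentiable* at $(x,\omega)$, $x\notin\omega$, if for some open neighbourhood $V$ of $x$ and some $\Lambda\supset V$ the function $y\mapsto H_\Lambda(\omega\cup y)$ on $V$ is either finite near $x$ and differentiable at $x$, or identically $+\infty$. $\nabla H(x,\omega)$ denotes its gradient at $x$ if the first case occurs for some such $\Lambda$ (it does not depend on that $\Lambda$), and $0$ otherwise. The family is *a.e. differentiable* if for every $\omega$ it is differentiable at $(x,\omega)$ for Lebesgue-a.e. $x$. A probability measure $P$ on $\Omega$ is a *canonical Gibbs measure* for $(H_\Lambda)$ if $P(\Omega_\infty)=1$ and, for every $\Lambda$ and every nonnegative measurable $g$ on $\Omega$, $$\int g\,dP=\sum_{k\ge0}\int\int_{\Lambda^k}\mathbf 1\{N_\Lambda(\omega)=k\}\,g(x_{1\ldots k}\cup\omega_{\Lambda^c})\,f_{\Lambda,k}(x_{1\ldots k}\cup\omega_{\Lambda^c})\,dx_1\cdots dx_k\,P(d\omega),$$ where $x_{1\ldots k}=\{x_1,\ldots,x_k\}$,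 $f_{\Lambda,k}(\omega)=Z_{\Lambda,k}(\omega_{\Lambda^c})^{-1}e^{-H_\Lambda(\omega)}\mathbf 1\{N_\Lambda(\omega)=k\}$, $Z_{\Lambda,k}(\omega_{\Lambda^c})=\int_{\Lambda^k}e^{-H_\Lambda(x_{1\ldots k}\cup\omega_{\Lambda^c})}dx_1\cdots dx_k$, and $f_{\Lambda,k}=0$ where $Z_{\Lambda,k}\notin(0,\infty)$. $P$ is *stationary* if $P\circ\tau_u^{-1}=P$ for all $u$; its intensity $z(P)$ is the mean number of points in $[0,1]^d$. If $P$ is stationary and $0<z(P)<\infty$, its *reduced Palm measure* $P_0^!$ is the unique probability measure on $\Omega$ with $$\int\sum_{x\in\omega}g(x,\omega\setminus x)\,P(d\omega)=z(P)\int_{\mathbb R^d}\int g(x,\tau_x\omega)\,P_0^!(d\omega)\,dx$$ for all measurable $g:\mathbb R^d\times\Omega\to[0,\infty]$. Let $\mathcal C_\tau$ be the class of measurable $g:\mathbb R^d\times\Omega\to\mathbb R$ that are shift-invariant, $g(\tau_ux,\tau_u\omega)=g(x,\omega)$; such that $x\mapsto g(x,\omega)$ is differentiable at a.e. $x$, for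 every $\omega$ (gradient $\nabla g(x,\omega)$); and *regularizing*: for every $\omega$, every $a>0$, every $1\le i\le d$ and a.e. choice of the coordinates $x^{(j)}\in[-a,a]$, $j\ne i$, the function $x^{(i)}\mapsto g(x,\omega)e^{-H_{[-a,a]^d}(\omega\cup x)}$ is absolutely continuous on $[-a,a]$. **Proposition 2.** Let $(H_\Lambda)$ be an integrable, a.e. differentiable, shift-invariant family of energies and let $P$ be a stationary canonical Gibbs measure for $(H_\Lambda)$ with $0<z(P)<\infty$. Then for every $g\in\mathcal C_\tau$ such that $$E_{P_0^!}\bigl(|\nabla g(0,\omega)|+|g(0,\omega)|+|g(0,\omega)\nabla H(0,\omega)|\bigr)<\infty$$ (the functions of $\omega$ occurring here being $P_0^!$-measurable), we have $$E_{P_0^!}\bigl(\nabla g(0,\omega)\bigr)=E_{P_0^!}\bigl(g(0,\omega)\nabla H(0,\omega)\bigr).$$ -/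

import Mathlib

open MeasureTheory Filter Topology
open scoped ENNReal

noncomputable section

namespace PointProcess

/-- Points of the Euclidean space `ℝ^d`. -/
abbrev Pt (d : ℕ) := EuclideanSpace ℝ (Fin d)

/-- Bounded Borel sets. -/
def BddBorel {d : ℕ} (L : Set (Pt d)) : Prop :=
  Bornology.IsBounded L ∧ MeasurableSet L

/-- A configuration: a locally finite subset of `ℝ^d`. -/
@[ext] structure Config (d : ℕ) where
  /-- the set of points -/
  pts : Set (Pt d)
  finite_inter : ∀ L : Set (Pt d), Bornology.IsBounded L → (pts ∩ L).Finite

namespace Config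

variable {d : ℕ}

/-- The number `N_L(ω)` of points of `ω` in `L` (used for bounded `L`). -/
def count (L : Set (Pt d)) (ω : Config d) : ℕ := (ω.pts ∩ L).ncard

/-- The σ-algebra generated by the counting variables of bounded Borel sets. -/
instance : MeasurableSpace (Config d) :=
  ⨆ (L : Set (Pt d)) (_ : BddBorel L), MeasurableSpace.comap (count L) ⊤

/-- The restriction `ω ∩ S`. -/
def restrict (ω : Config d) (S : Set (Pt d)) : Config d where
  pts := ω.pts ∩ S
  finite_inter L hL := (ω.finite_inter L hL).subset (by intro x hx; exact ⟨hx.1.1, hx.2⟩)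

instance : Union (Config d) where
  union ω η :=
    { pts := ω.pts ∪ η.pts
      finite_inter := fun L hL => by
        rw [Set.union_inter_distrib_right]
        exact (ω.finite_inter L hL).union (η.finite_inter L hL) }

/-- The configuration `{x_1, …, x_k}`. -/
def ofTuple {k : ℕ} (x : Fin k → Pt d) : Config d where
  pts := Set.range x
  finite_inter _ _ := (Set.finite_range x).inter_of_left _

/-- The configuration `ω ∪ {x}`. -/
def insert (ω : Config d) (x : Pt d) : Config d where
  pts := Insert.insert x ω.pts
  finite_inter L hL := ((ω.finite_inter L hL).insert x).subset (by
    rintro y ⟨hy | hy, hL⟩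
    · exact Or.inl hy
    · exact Or.inr ⟨hy, hL⟩)

/-- The configuration `ω ∖ {x}`. -/
def erase (ω : Config d) (x : Pt d) : Config d where
  pts := ω.pts \ {x}
  finite_inter L hL := (ω.finite_inter L hL).subset (by intro y hy; exact ⟨hy.1.1, hy.2⟩)

/-- The translate `τ_u ω = {x + u : x ∈ ω}`. -/
def shift (u : Pt d) (ω : Config d) : Config d where
  pts := (fun x => x + u) '' ω.pts
  finite_inter L hL := by
    have hb : Bornology.IsBounded ((fun x => x + u) ⁻¹' L) := by
      have h := (isometry_add_right (-u)).lipschitz.isBounded_image hL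
      refine h.subset ?_
      intro x hx
      exact ⟨x + u, hx, by simp⟩
    refine ((ω.finite_inter _ hb).image (fun x => x + u)).subset ?_
    rintro _ ⟨⟨x, hx, rfl⟩, hL'⟩
    exact ⟨x, ⟨hx, hL'⟩, rfl⟩

/-- The configuration of a tuple depends measurably on the tuple. -/
theorem measurable_ofTuple (k : ℕ) : Measurable (ofTuple : (Fin k → Pt d) → Config d) := by
  have hcount : ∀ L : Set (Pt d), BddBorel L →
      Measurable (fun x : Fin k → Pt d => count L (ofTuple x)) := by
    intro L hL
    classical
    have key : ∀ x : Fin k → Pt d, count L (ofTuple x) =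
        ∑ i : Fin k, if x i ∈ L ∧ ∀ j, j < i → x j ≠ x i then 1 else 0 := by
      intro x
      rw [← Finset.card_filter]
      have hset : (ofTuple x).pts ∩ L =
          x '' (Finset.univ.filter (fun i => x i ∈ L ∧ ∀ j, j < i → x j ≠ x i) :
            Finset (Fin k)) := by
        ext y
        constructor
        · rintro ⟨⟨i, rfl⟩, hiL⟩
          have hne : (Finset.univ.filter (fun j => x j = x i)).Nonempty := ⟨i, by simp⟩
          set m := (Finset.univ.filter (fun j => x j = x i)).min' hne with hm
          have hmem : x m = x i := by
            have := Finset.min'_mem _ hne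
            rw [← hm] at this
            simpa using this
          refine ⟨m, ?_, hmem⟩
          simp only [Finset.coe_filter, Finset.mem_univ, true_and, Set.mem_ofPred_eq]
          refine ⟨hmem ▸ hiL, fun j hj hjm => ?_⟩
          have : m ≤ j := Finset.min'_le _ _ (by simp [hjm, hmem])
          exact absurd hj (not_lt.mpr this)
        · rintro ⟨i, hi, rfl⟩
          simp only [Finset.coe_filter, Finset.mem_univ, true_and, Set.mem_ofPred_eq] at hi
          exact ⟨⟨i, rfl⟩, hi.1⟩
      rw [count, hset, Set.InjOn.ncard_image, Set.ncard_coe_finset]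
      intro a ha b hb hab
      simp only [Finset.coe_filter, Finset.mem_univ, true_and, Set.mem_ofPred_eq] at ha hb
      rcases lt_trichotomy a b with h | h | h
      · exact absurd hab (hb.2 a h)
      · exact h
      · exact absurd hab.symm (ha.2 b h)
    simp only [key]
    refine Finset.measurable_sum _ fun i _ => Measurable.ite ?_ measurable_const measurable_const
    have h1 : MeasurableSet {x : Fin k → Pt d | x i ∈ L} := measurable_pi_apply i hL.2
    have h2 : MeasurableSet {x : Fin k → Pt d | ∀ j, j < i → x j ≠ x i} := by
      simp only [Set.ofPred_forall]
      refine MeasurableSet.iInter fun j => MeasurableSet.iInter fun _ => ?_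
      exact (measurableSet_eq_fun (measurable_pi_apply j) (measurable_pi_apply i)).compl
    exact h1.inter h2
  rw [measurable_iff_comap_le]
  simp only [instMeasurableSpace, MeasurableSpace.comap_iSup, MeasurableSpace.comap_comp]
  exact iSup₂_le fun L hL => (hcount L hL).comap_le

end Config

variable {d : ℕ}

/-- The cube `[-a, a]^d`. -/
def cube (d : ℕ) (a : ℝ) : Set (Pt d) := {x | ∀ i, x i ∈ Set.Icc (-a) a}

/-- Lebesgue measure on `L^k`. -/
def lebPow (L : Set (Pt d)) (k : ℕ) : Measure (Fin k → Pt d) :=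
  Measure.pi fun _ => (volume : Measure (Pt d)).restrict L

/-- The Poisson point process of intensity `z` in a bounded Borel set `L`: the number of points
is Poisson with parameter `z |L|` and, given that it is `k`, the points are independent and
uniform in `L`. -/
def poissonIn (z : ℝ) (L : Set (Pt d)) : Measure (Config d) :=
  Measure.sum fun k : ℕ =>
    ENNReal.ofReal (Real.exp (-(z * (volume L).toReal)) * z ^ k / k.factorial) •
      (lebPow L k).map Config.ofTuple

/-! ### Energies -/

/-- A family of energies `H_L : Ω → ℝ ∪ {+∞}` indexed by the bounded Borel sets `L` (the values
of `H` at other sets are irrelevant). -/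
structure IsEnergyFamily (H : Set (Pt d) → Config d → EReal) : Prop where
  measurable : ∀ L, BddBorel L → Measurable (H L)
  ne_bot : ∀ L, BddBorel L → ∀ ω, H L ω ≠ ⊥
  compatible : ∀ L L', BddBorel L → BddBorel L' → L ⊆ L' →
    ∃ φ : Config d → EReal, Measurable φ ∧ (∀ ω, φ ω ≠ ⊥) ∧
      ∀ ω, H L' ω = H L ω + φ (ω.restrict Lᶜ)

/-- The configurations of locally finite energy. -/
def finiteEnergy (H : Set (Pt d) → Config d → EReal) : Set (Config d) :=
  {ω | ∀ L, BddBorel L → H L ω ≠ ⊤}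

/-- Integrability of the energies with respect to the Poisson process of intensity `z`. -/
def IsIntegrableFamily (z : ℝ) (H : Set (Pt d) → Config d → EReal) : Prop :=
  ∀ L, BddBorel L → volume L ≠ 0 → ∀ ω ∈ finiteEnergy H,
    0 < ∫⁻ η, EReal.exp (-(H L (η.restrict L ∪ ω.restrict Lᶜ))) ∂(poissonIn z L) ∧
    ∫⁻ η, EReal.exp (-(H L (η.restrict L ∪ ω.restrict Lᶜ))) ∂(poissonIn z L) < ∞

/-- Shift invariance of the energies. -/
def IsShiftInvariantFamily (H : Set (Pt d) → Config d → EReal) : Prop :=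
  ∀ (u : Pt d) (ω : Config d) (L : Set (Pt d)), BddBorel L →
    H L ω = H ((fun x => x + u) '' L) (ω.shift u)

/-! ### Canonical Gibbs measures -/

/-- `Z_{L,k}(ω_{Lᶜ})`, as a function of `ω`. -/
def partitionFn (H : Set (Pt d) → Config d → EReal) (L : Set (Pt d)) (k : ℕ)
    (ω : Config d) : ℝ≥0∞ :=
  ∫⁻ x, EReal.exp (-(H L (Config.ofTuple x ∪ ω.restrict Lᶜ))) ∂(lebPow L k)

open Classical in
/-- The local conditional density `f_{L,k}`; it is set to zero where the normalization
`Z_{L,k}` is not in `(0, ∞)`. -/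
def localDensity (H : Set (Pt d) → Config d → EReal) (L : Set (Pt d)) (k : ℕ)
    (ω : Config d) : ℝ≥0∞ :=
  if ω.count L = k ∧ partitionFn H L k ω ≠ 0 ∧ partitionFn H L k ω ≠ ∞ then
    EReal.exp (-(H L ω)) / partitionFn H L k ω
  else 0

open Classical in
/-- `P` is a canonical Gibbs measure for `H`. The DLR equations are required for all nonnegative
measurable `g`, which is the same as requiring them for all integrable `g`. -/
structure IsCanonicalGibbs (H : Set (Pt d) → Config d → EReal) (P : Measure (Config d)) :
    Prop where
  isProbabilityMeasure : IsProbabilityMeasure P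
  ae_finiteEnergy : ∀ᵐ ω ∂P, ω ∈ finiteEnergy H
  dlr : ∀ L, BddBorel L → ∀ g : Config d → ℝ≥0∞, Measurable g →
    ∫⁻ ω, g ω ∂P =
      ∑' k : ℕ, ∫⁻ ω, ∫⁻ x,
        (if ω.count L = k then 1 else 0) * g (Config.ofTuple x ∪ ω.restrict Lᶜ) *
          localDensity H L k (Config.ofTuple x ∪ ω.restrict Lᶜ) ∂(lebPow L k) ∂P

/-! ### Stationarity and Palm measures -/

/-- Stationarity: invariance in law under all translations. -/
def IsStationaryLaw (P : Measure (Config d)) : Prop :=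
  ∀ u : Pt d, P.map (Config.shift u) = P

/-- The intensity `z(P)`: the mean number of points in the unit cube. -/
def intensity (P : Measure (Config d)) : ℝ≥0∞ :=
  ∫⁻ ω, (ω.count {x | ∀ i, x i ∈ Set.Icc (0 : ℝ) 1} : ℝ≥0∞) ∂P

/-- The integral of `g ≥ 0` against the reduced Campbell measure of `P`. -/
def campbell (P : Measure (Config d)) (g : Pt d → Config d → ℝ≥0∞) : ℝ≥0∞ :=
  ∫⁻ ω, ∑' x : ω.pts, g x (ω.erase x) ∂P

/-- `P₀` is the reduced Palm measure of the stationary measure `P` (it is unique if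
`0 < z(P) < ∞`). -/
structure IsReducedPalm (P P₀ : Measure (Config d)) : Prop where
  isProbabilityMeasure : IsProbabilityMeasure P₀
  campbell_eq : ∀ g : Pt d → Config d → ℝ≥0∞, Measurable (Function.uncurry g) →
    campbell P g = intensity P * ∫⁻ x, ∫⁻ ω, g x (ω.shift x) ∂P₀

/-! ### Differentiability of the energies -/

/-- For some bounded Borel neighbourhood `L` of `x`, the function `y ↦ H_L(ω ∪ y)` is finite
near `x` and has gradient `v` at `x`. -/
def HasEnergyGradient (H : Set (Pt d) → Config d → EReal) (x : Pt d) (ω : Config d)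
    (v : Pt d) : Prop :=
  x ∉ ω.pts ∧ ∃ L, BddBorel L ∧ L ∈ 𝓝 x ∧ (∀ᶠ y in 𝓝 x, H L (ω.insert y) ≠ ⊤) ∧
    HasGradientAt (fun y => (H L (ω.insert y)).toReal) v x

/-- For some bounded Borel neighbourhood `L` of `x`, the function `y ↦ H_L(ω ∪ y)` is infinite
near `x`. -/
def EnergyInfiniteNear (H : Set (Pt d) → Config d → EReal) (x : Pt d) (ω : Config d) : Prop :=
  x ∉ ω.pts ∧ ∃ L, BddBorel L ∧ L ∈ 𝓝 x ∧ ∀ᶠ y in 𝓝 x, H L (ω.insert y) = ⊤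

/-- Differentiability of the family `H` at `(x, ω)`. -/
def EnergyDifferentiableAt (H : Set (Pt d) → Config d → EReal) (x : Pt d) (ω : Config d) :
    Prop :=
  (∃ v, HasEnergyGradient H x ω v) ∨ EnergyInfiniteNear H x ω

open Classical in
/-- The gradient `∇H(x, ω)`: the gradient of `y ↦ H_L(ω ∪ y)` at `x` if this function is finite
near `x` and differentiable at `x` for some `L` (by compatibility all such `L` give the same
vector), and zero if there is no such `L`, in particular, by convention, where the energies are
infinite near `x`. -/
def gradH (H : Set (Pt d) → Config d → EReal) (x : Pt d) (ω : Config d) : Pt d :=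
  if h : ∃ v, HasEnergyGradient H x ω v then h.choose else 0

/-- Almost everywhere differentiability of the family `H`. -/
def IsAEDifferentiableFamily (H : Set (Pt d) → Config d → EReal) : Prop :=
  ∀ ω : Config d, ∀ᵐ x : Pt d, EnergyDifferentiableAt H x ω

/-! ### Test functions -/

/-- The point of `ℝ^d` with `i`-th coordinate `t` and the other coordinates given by `y`. -/
def linePoint (i : Fin d) (y : {j : Fin d // j ≠ i} → ℝ) (t : ℝ) : Pt d :=
  WithLp.toLp 2 fun j => if h : j = i then t else y ⟨j, h⟩

/-- `g` is regularizing with respect to `H`. -/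
def IsRegularizing (H : Set (Pt d) → Config d → EReal) (g : Pt d → Config d → ℝ) : Prop :=
  ∀ (ω : Config d) (a : ℝ), 0 < a → ∀ i : Fin d,
    ∀ᵐ y : {j : Fin d // j ≠ i} → ℝ, (∀ j, y j ∈ Set.Icc (-a) a) →
      AbsolutelyContinuousOnInterval
        (fun t => g (linePoint i y t) ω *
          (EReal.exp (-(H (cube d a) (ω.insert (linePoint i y t))))).toReal) (-a) a

/-- The class of shift-invariant, measurable, almost everywhere differentiable and regularizing
test functions. -/
structure IsShiftInvariantTest (H : Set (Pt d) → Config d → EReal) (g : Pt d → Config d → ℝ) :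
    Prop where
  measurable : Measurable (Function.uncurry g)
  ae_differentiable : ∀ ω, ∀ᵐ x : Pt d, DifferentiableAt ℝ (fun y => g y ω) x
  regularizing : IsRegularizing H g
  shift_invariant : ∀ u x ω, g (x + u) (ω.shift u) = g x ω

end PointProcess

end

open PointProcess

/-!
The identity is an integration by parts in the position of one point of the configuration.

Fix the cube `[-1, 1]^d` and a direction `i`. By the DLR equations, the reduced Campbell measure
of `P` over the cube disintegrates as `e^{-H(η ∪ y)} dy M(dη)`, with `H` the energy in the cube and
`M` some measure on the environments `η` of the point `y`
(`IsCanonicalGibbs.exists_campbell_disintegration`). For a fixed environment, integrate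
`∂_i [(1 - y_i²) g(y, η) e^{-H(η ∪ y)}]` over the cube: by absolute continuity on almost
every line in direction `i` and since the cutoff `1 - y_i²` vanishes at the ends of the line, the
result is zero (`integral_cube_eq_zero`). Where `e^{-H(η ∪ y)} = 0` the derivative of the absolutely
continuous function vanishes almost everywhere (`ae_deriv_eq_zero_of_eq_zero`); elsewhere
`η ∪ y` has locally finite energy for almost every `η`, which excludes the degenerate alternative
in the differentiability of the energies, and the derivative is
`[(1 - y_i²) (∂_i g - g ∂_i H) - 2 y_i g] e^{-H}`.

Integrating over `η` and using the Campbell formula together with the shift invariance of all the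
functions involved, one gets, up to the factor given by the intensity,
`∫ (1 - y_i²) dy · E[∂_i g - g ∂_i H] - ∫ 2 y_i dy · E[g] = 0`,
where the integrals are over the cube, the expectations under the reduced Palm measure and the
functions in them evaluated at the origin. The second term is zero by symmetry and the first integral
is positive (`integral_eq_zero_of_integral_cutoff_eq_zero`). With such a cutoff there are no boundary
terms, and no limit of large cubes is needed.

The gradients are only known to be measurable as functions of the environment of the origin, and
up to null sets. Their measurable versions are transported to all points by the shifts. This and
the use of the DLR equations rest on the joint measurability of shifting, inserting and erasing
points, which comes from `measurable_tsum_pts`.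
-/

open MeasureTheory Filter Topology
open scoped ENNReal

namespace PointProcess

variable {d : ℕ}

/-! ### Measurability of operations on configurations -/

theorem measurable_count {L : Set (Pt d)} (hL : BddBorel L) :
    Measurable (Config.count L : Config d → ℕ) :=
  measurable_iff_comap_le.2 (le_iSup₂ (f := fun (L : Set (Pt d)) (_ : BddBorel L) =>
    MeasurableSpace.comap (Config.count L) ⊤) L hL)

theorem measurable_config_of_count {α : Type*} [MeasurableSpace α] {f : α → Config d}
    (hf : ∀ L, BddBorel L → Measurable fun a => (f a).count L) : Measurable f := by
  rw [measurable_iff_comap_le]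
  simp only [Config.instMeasurableSpace, MeasurableSpace.comap_iSup, MeasurableSpace.comap_comp]
  exact iSup₂_le fun L hL => (hf L hL).comap_le

/-- The spherical shells `{x | ⌊‖x‖⌋ = n}`, a countable partition of `ℝ^d` into bounded Borel
sets. -/
def shell (d n : ℕ) : Set (Pt d) := {x | ⌊‖x‖⌋₊ = n}

theorem measurableSet_shell (n : ℕ) : MeasurableSet (shell d n) :=
  (Nat.measurable_floor.comp measurable_norm) (measurableSet_singleton n)

theorem isBounded_shell (n : ℕ) : Bornology.IsBounded (shell d n) := by
  refine (Metric.isBounded_closedBall (x := (0 : Pt d)) (r := n + 1)).subset fun x hx => ?_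
  have h : ⌊‖x‖⌋₊ = n := hx
  rw [mem_closedBall_zero_iff, ← h]
  exact (Nat.lt_floor_add_one _).le

theorem bddBorel_inter_shell {A : Set (Pt d)} (hA : MeasurableSet A) (n : ℕ) :
    BddBorel (A ∩ shell d n) :=
  ⟨(isBounded_shell n).subset Set.inter_subset_right, hA.inter (measurableSet_shell n)⟩

theorem iUnion_inter_shell (S : Set (Pt d)) : ⋃ n, S ∩ shell d n = S := by
  ext x
  simp [shell]

theorem Config.finite_inter_shell (ω : Config d) (n : ℕ) : (ω.pts ∩ shell d n).Finite :=
  ω.finite_inter _ (isBounded_shell n)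

theorem Config.countable_pts (ω : Config d) : ω.pts.Countable := by
  rw [← iUnion_inter_shell ω.pts]
  exact Set.countable_iUnion fun n => (ω.finite_inter_shell n).countable

/-- The counting measure of the points of `ω` in the `n`-th shell. -/
noncomputable def shellMeasure (n : ℕ) (ω : Config d) : Measure (Pt d) :=
  Measure.count.restrict (ω.pts ∩ shell d n)

instance (n : ℕ) (ω : Config d) : IsFiniteMeasure (shellMeasure n ω) :=
  ⟨by
    rw [shellMeasure, Measure.restrict_apply_univ]
    exact Measure.count_apply_lt_top.2 (ω.finite_inter_shell n)⟩

theorem shellMeasure_apply (n : ℕ) (ω : Config d) {A : Set (Pt d)} (hA : MeasurableSet A) :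
    shellMeasure n ω A = (ω.count (A ∩ shell d n) : ℝ≥0∞) := by
  have hset : A ∩ (ω.pts ∩ shell d n) = ω.pts ∩ (A ∩ shell d n) := by
    ext x; simp only [Set.mem_inter_iff]; tauto
  have hfin : (ω.pts ∩ (A ∩ shell d n)).Finite := ω.finite_inter _ (bddBorel_inter_shell hA n).1
  rw [shellMeasure, Measure.restrict_apply hA, hset, Measure.count_apply_finite _ hfin,
    Config.count, Set.ncard_eq_toFinset_card _ hfin]

theorem tsum_pts_eq_tsum_lintegral (ω : Config d) (f : Pt d → ℝ≥0∞) :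
    ∑' y : ω.pts, f y = ∑' n, ∫⁻ y, f y ∂(shellMeasure n ω) := by
  have h := lintegral_countable (μ := Measure.count) f ω.countable_pts
  simp only [Measure.count_singleton, mul_one] at h
  rw [← h]
  conv_lhs => rw [← iUnion_inter_shell ω.pts]
  rw [lintegral_iUnion (fun n => (ω.finite_inter_shell n).measurableSet)]
  · rfl
  · intro m n hmn
    refine Set.disjoint_left.2 fun x hx hx' => hmn ?_
    exact hx.2.symm.trans hx'.2

/-- Campbell-type measurability: sums of a measurable function over the points of a configuration
depend measurably on the configuration and on a parameter. With suitable functions this gives the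
measurability of membership, and of shifting, inserting and erasing points. -/
theorem measurable_tsum_pts {α : Type*} [MeasurableSpace α] {h : α × Pt d → ℝ≥0∞}
    (hh : Measurable h) :
    Measurable fun p : α × Config d => ∑' y : p.2.pts, h (p.1, y) := by
  have hsum : ∀ p : α × Config d, ∑' y : p.2.pts, h (p.1, y) =
      ∑' n, ∫⁻ y, h (p.1, y) ∂(shellMeasure n p.2) :=
    fun p => tsum_pts_eq_tsum_lintegral p.2 fun y => h (p.1, y)
  simp only [hsum]
  refine Measurable.tsum fun n => ?_
  have hm : Measurable fun p : α × Config d => (Measure.dirac p.1).prod (shellMeasure n p.2) := by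
    refine Measurable.measure_of_isPiSystem generateFrom_prod.symm isPiSystem_prod ?_ ?_
    · rintro _ ⟨A, hA, B, hB, rfl⟩
      simp only [Measure.prod_prod, shellMeasure_apply _ _ hB]
      exact ((Measure.measurable_coe hA).comp (Measure.measurable_dirac.comp measurable_fst)).mul
        (measurable_from_top.comp
          ((measurable_count (bddBorel_inter_shell hB n)).comp measurable_snd))
    · simp only [← Set.univ_prod_univ, Measure.prod_prod,
        shellMeasure_apply _ _ MeasurableSet.univ, measure_univ, one_mul]
      exact measurable_from_top.comp
          ((measurable_count (bddBorel_inter_shell MeasurableSet.univ n)).comp measurable_snd)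
  have heq : ∀ p : α × Config d, ∫⁻ y, h (p.1, y) ∂(shellMeasure n p.2) =
      ∫⁻ q, h q ∂((Measure.dirac p.1).prod (shellMeasure n p.2)) := by
    intro p
    rw [lintegral_prod _ hh.aemeasurable, lintegral_dirac' _ hh.lintegral_prod_right']
  simp only [heq]
  exact (Measure.measurable_lintegral hh).comp hm

theorem tsum_pts_indicator (ω : Config d) (S : Set (Pt d)) :
    ∑' y : ω.pts, S.indicator (fun _ => (1 : ℝ≥0∞)) y = ((ω.pts ∩ S).encard : ℝ≥0∞) := by
  rw [tsum_subtype ω.pts (S.indicator fun _ => (1 : ℝ≥0∞)), Set.indicator_indicator,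
    ← tsum_subtype (ω.pts ∩ S) (fun _ => (1 : ℝ≥0∞)), ENNReal.tsum_set_one]

theorem tsum_pts_indicator_of_bddBorel (ω : Config d) {L : Set (Pt d)} (hL : BddBorel L) :
    ∑' y : ω.pts, L.indicator (fun _ => (1 : ℝ≥0∞)) y = (ω.count L : ℝ≥0∞) := by
  rw [tsum_pts_indicator, Config.count, ← (ω.finite_inter L hL.1).cast_ncard_eq]
  simp

theorem measurable_of_natCast {α : Type*} [MeasurableSpace α] {f : α → ℕ}
    (hf : Measurable fun a => (f a : ℝ≥0∞)) : Measurable f := by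
  refine measurable_to_countable' fun n => ?_
  have : f ⁻¹' {n} = (fun a => (f a : ℝ≥0∞)) ⁻¹' {(n : ℝ≥0∞)} := by
    ext a; simp
  rw [this]
  exact hf (measurableSet_singleton _)

theorem measurableSet_mem_pts : MeasurableSet {p : Pt d × Config d | p.1 ∈ p.2.pts} := by
  classical
  have hdiag : Measurable ((Set.diagonal (Pt d)).indicator fun _ => (1 : ℝ≥0∞)) :=
    measurable_const.indicator measurableSet_diagonal
  have h := measurable_tsum_pts hdiag
  have heq : {p : Pt d × Config d | p.1 ∈ p.2.pts} =
      (fun p : Pt d × Config d => ∑' y : p.2.pts,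
        (Set.diagonal (Pt d)).indicator (fun _ => (1 : ℝ≥0∞)) (p.1, (y : Pt d))) ⁻¹' {0}ᶜ := by
    ext p
    simp only [Set.mem_ofPred_eq, Set.mem_preimage, Set.mem_compl_iff, Set.mem_singleton_iff,
      ENNReal.tsum_eq_zero, not_forall, Set.indicator_apply, Set.mem_diagonal_iff]
    constructor
    · intro hp
      exact ⟨⟨p.1, hp⟩, by simp⟩
    · rintro ⟨y, hy⟩
      by_cases hpy : p.1 = y
      · exact hpy ▸ y.2
      · simp [hpy] at hy
  rw [heq]
  exact h (measurableSet_singleton _).compl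

theorem measurable_shift : Measurable fun p : Pt d × Config d => p.2.shift p.1 := by
  refine measurable_config_of_count fun L hL => measurable_of_natCast ?_
  have hm : Measurable fun q : Pt d × Pt d => L.indicator (fun _ => (1 : ℝ≥0∞)) (q.2 + q.1) :=
    (measurable_const.indicator hL.2).comp (measurable_snd.add measurable_fst)
  convert! measurable_tsum_pts hm using 1
  funext p
  rw [← tsum_pts_indicator_of_bddBorel _ hL]
  symm
  exact ((Equiv.Set.image (fun x => x + p.1) p.2.pts (add_left_injective p.1)).tsum_eq
    (fun y : (p.2.shift p.1).pts => L.indicator (fun _ => (1 : ℝ≥0∞)) (y : Pt d)))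

theorem Config.count_insert (ω : Config d) (x : Pt d) {L : Set (Pt d)} (hL : BddBorel L)
    [Decidable (x ∈ L ∧ x ∉ ω.pts)] :
    (ω.insert x).count L = ω.count L + if x ∈ L ∧ x ∉ ω.pts then 1 else 0 := by
  have hfin := ω.finite_inter L hL.1
  simp only [Config.count, Config.insert]
  by_cases hx : x ∈ L
  · rw [Set.insert_inter_of_mem hx]
    by_cases hω : x ∈ ω.pts
    · rw [Set.insert_eq_of_mem (show x ∈ ω.pts ∩ L from ⟨hω, hx⟩)]
      simp [hω]
    · rw [Set.ncard_insert_of_notMem (fun h => hω h.1) hfin]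
      simp [hω, hx]
  · rw [Set.insert_inter_of_notMem hx]
    simp [hx]

theorem Config.count_erase (ω : Config d) (x : Pt d) (L : Set (Pt d))
    [Decidable (x ∈ L ∧ x ∈ ω.pts)] :
    (ω.erase x).count L = ω.count L - if x ∈ L ∧ x ∈ ω.pts then 1 else 0 := by
  have hset : (ω.pts \ {x}) ∩ L = (ω.pts ∩ L) \ {x} := by
    ext y; simp only [Set.mem_inter_iff, Set.mem_sdiff]; tauto
  simp only [Config.count, Config.erase, hset]
  by_cases hx : x ∈ ω.pts ∩ L
  · rw [Set.ncard_sdiff_singleton_of_mem hx, if_pos ⟨hx.2, hx.1⟩]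
  · rw [Set.sdiff_singleton_eq_self hx, if_neg fun h => hx ⟨h.2, h.1⟩, Nat.sub_zero]

theorem measurable_insert : Measurable fun p : Pt d × Config d => p.2.insert p.1 := by
  classical
  refine measurable_config_of_count fun L hL => ?_
  simp only [Config.count_insert _ _ hL]
  exact ((measurable_count hL).comp measurable_snd).add
    (Measurable.ite ((measurable_fst hL.2).inter measurableSet_mem_pts.compl)
      measurable_const measurable_const)

theorem measurable_erase : Measurable fun p : Pt d × Config d => p.2.erase p.1 := by
  classical
  refine measurable_config_of_count fun L hL => ?_
  simp only [Config.count_erase]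
  exact ((measurable_count hL).comp measurable_snd).sub
    (Measurable.ite ((measurable_fst hL.2).inter measurableSet_mem_pts)
      measurable_const measurable_const)

/-- The configuration `η_Λ ∪ ω_{Λᶜ}` depends measurably on `(η, ω)`. -/
theorem measurable_glue {S : Set (Pt d)} (hS : MeasurableSet S) :
    Measurable fun p : Config d × Config d => p.1.restrict S ∪ p.2.restrict Sᶜ := by
  refine measurable_config_of_count fun L hL => ?_
  have h1 : BddBorel (S ∩ L) := ⟨hL.1.subset Set.inter_subset_right, hS.inter hL.2⟩
  have h2 : BddBorel (Sᶜ ∩ L) := ⟨hL.1.subset Set.inter_subset_right, hS.compl.inter hL.2⟩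
  have heq : ∀ p : Config d × Config d, (p.1.restrict S ∪ p.2.restrict Sᶜ).count L =
      p.1.count (S ∩ L) + p.2.count (Sᶜ ∩ L) := by
    intro p
    have hset : (p.1.restrict S ∪ p.2.restrict Sᶜ).pts ∩ L =
        (p.1.pts ∩ (S ∩ L)) ∪ (p.2.pts ∩ (Sᶜ ∩ L)) := by
      show ((p.1.pts ∩ S) ∪ (p.2.pts ∩ Sᶜ)) ∩ L = _
      rw [Set.union_inter_distrib_right, Set.inter_assoc, Set.inter_assoc]
    simp only [Config.count, hset]
    refine Set.ncard_union_eq ?_ (p.1.finite_inter _ h1.1) (p.2.finite_inter _ h2.1)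
    exact Set.disjoint_left.2 fun x hx hx' => hx'.2.1 hx.2.1
  simp only [heq]
  exact ((measurable_count h1).comp measurable_fst).add ((measurable_count h2).comp measurable_snd)

theorem measurable_tsum_erase {h : Pt d × Config d → ℝ≥0∞} (hh : Measurable h) :
    Measurable fun ω : Config d => ∑' x : ω.pts, h (x, ω.erase x) := by
  have h1 : Measurable fun q : Config d × Pt d => h (q.2, q.1.erase q.2) :=
    hh.comp (measurable_snd.prodMk (measurable_erase.comp measurable_swap))
  exact (measurable_tsum_pts h1).comp (measurable_id.prodMk measurable_id)

/-! ### Disintegration of the reduced Campbell measure -/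

instance (L : Set (Pt d)) (k : ℕ) : SigmaFinite (lebPow L k) :=
  inferInstanceAs (SigmaFinite (Measure.pi fun _ => (volume : Measure (Pt d)).restrict L))

theorem ae_mem_lebPow {L : Set (Pt d)} (hL : MeasurableSet L) (k : ℕ) :
    ∀ᵐ x ∂(lebPow L k), ∀ i, x i ∈ L :=
  ae_all_iff.2 fun _ => Measure.tendsto_eval_ae_ae.eventually (ae_restrict_mem hL)

theorem measurePreserving_piFinSuccAbove_lebPow (L : Set (Pt d)) {m : ℕ} (j : Fin (m + 1)) :
    MeasurePreserving (MeasurableEquiv.piFinSuccAbove (fun _ : Fin (m + 1) => Pt d) j)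
      (lebPow L (m + 1)) (((volume : Measure (Pt d)).restrict L).prod (lebPow L m)) :=
  measurePreserving_piFinSuccAbove (fun _ => (volume : Measure (Pt d)).restrict L) j

theorem lintegral_lebPow_succ (L : Set (Pt d)) {m : ℕ} (j : Fin (m + 1))
    {f : (Fin (m + 1) → Pt d) → ℝ≥0∞} (hf : Measurable f) :
    ∫⁻ x, f x ∂(lebPow L (m + 1)) =
      ∫⁻ x, (∫⁻ y in L, f (Fin.insertNth j y x)) ∂(lebPow L m) := by
  have hmp := (measurePreserving_piFinSuccAbove_lebPow L j).symm
  rw [← hmp.lintegral_comp hf]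
  exact lintegral_prod_symm _ (hf.comp hmp.measurable).aemeasurable

theorem ae_injective_lebPow (hd : 1 ≤ d) (L : Set (Pt d)) (k : ℕ) :
    ∀ᵐ x ∂(lebPow L k), Function.Injective x := by
  have : Nonempty (Fin d) := ⟨⟨0, hd⟩⟩
  rcases k with _ | m
  · exact Eventually.of_forall fun x => Function.injective_of_subsingleton x
  have hq : ∀ᵐ q ∂(((volume : Measure (Pt d)).restrict L).prod (lebPow L m)),
      q.1 ∉ (Config.ofTuple q.2).pts := by
    have hs : MeasurableSet {q : Pt d × (Fin m → Pt d) | q.1 ∈ (Config.ofTuple q.2).pts} :=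
      (measurable_fst.prodMk ((Config.measurable_ofTuple m).comp measurable_snd))
        measurableSet_mem_pts
    rw [ae_iff]
    simp only [not_not]
    rw [Measure.prod_apply_symm hs, lintegral_eq_zero_of_ae_eq_zero]
    refine Eventually.of_forall fun x => ?_
    exact (Set.finite_range x).measure_zero _
  have hj : ∀ j : Fin (m + 1), ∀ᵐ x ∂(lebPow L (m + 1)), x j ∉ Set.range (j.removeNth x) :=
    fun j => (measurePreserving_piFinSuccAbove_lebPow L j).quasiMeasurePreserving.ae hq
  filter_upwards [ae_all_iff.2 hj] with x hx i j hij
  by_contra hne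
  obtain ⟨l, hl⟩ := Fin.exists_succAbove_eq hne
  exact hx j ⟨l, by simp [Fin.removeNth, hl, hij]⟩

namespace Config

theorem restrict_ofTuple {L : Set (Pt d)} {k : ℕ} {x : Fin k → Pt d} (hx : ∀ i, x i ∈ L) :
    (ofTuple x).restrict L = ofTuple x := by
  ext1
  exact Set.inter_eq_left.2 (Set.range_subset_iff.2 hx)

theorem glue_inter (η ω : Config d) (L : Set (Pt d)) :
    (η.restrict L ∪ ω.restrict Lᶜ).pts ∩ L = η.pts ∩ L := by
  ext y
  show ((y ∈ η.pts ∧ y ∈ L) ∨ (y ∈ ω.pts ∧ y ∉ L)) ∧ y ∈ L ↔ y ∈ η.pts ∧ y ∈ L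
  tauto

theorem glue_restrict_compl (η ω : Config d) (L : Set (Pt d)) :
    (η.restrict L ∪ ω.restrict Lᶜ).restrict Lᶜ = ω.restrict Lᶜ := by
  ext y
  show ((y ∈ η.pts ∧ y ∈ L) ∨ (y ∈ ω.pts ∧ y ∉ L)) ∧ y ∉ L ↔ y ∈ ω.pts ∧ y ∉ L
  tauto

theorem insertNth_pts {m : ℕ} (j : Fin (m + 1)) (y : Pt d) (x : Fin m → Pt d) :
    (ofTuple (Fin.insertNth j y x : Fin (m + 1) → Pt d)).pts = Insert.insert y (ofTuple x).pts :=
  Fin.range_insertNth (α := Pt d) j y x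

theorem insertNth_glue {L : Set (Pt d)} {m : ℕ} (j : Fin (m + 1)) {y : Pt d} (hy : y ∈ L)
    (x : Fin m → Pt d) (ω : Config d) :
    (ofTuple (Fin.insertNth j y x : Fin (m + 1) → Pt d)).restrict L ∪ ω.restrict Lᶜ =
      ((ofTuple x).restrict L ∪ ω.restrict Lᶜ).insert y := by
  ext z
  show (z ∈ (ofTuple (Fin.insertNth j y x : Fin (m + 1) → Pt d)).pts ∧ z ∈ L) ∨
    (z ∈ ω.pts ∧ z ∉ L) ↔ z = y ∨ ((z ∈ (ofTuple x).pts ∧ z ∈ L) ∨ (z ∈ ω.pts ∧ z ∉ L))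
  rw [insertNth_pts, Set.mem_insert_iff]
  by_cases hz : z = y
  · subst hz; tauto
  · tauto

theorem erase_insert {η : Config d} {y : Pt d} (hy : y ∉ η.pts) : (η.insert y).erase y = η := by
  ext1
  exact Set.insert_sdiff_self_of_notMem hy

theorem tsum_glue {L : Set (Pt d)} {k : ℕ} {x : Fin k → Pt d} (hx : ∀ i, x i ∈ L)
    (hinj : Function.Injective x) (ω : Config d) (f : Pt d → ℝ≥0∞) :
    ∑' y : ((ofTuple x).restrict L ∪ ω.restrict Lᶜ).pts, L.indicator f y = ∑ j, f (x j) := by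
  have hset : ((ofTuple x).restrict L ∪ ω.restrict Lᶜ).pts ∩ L = Set.range x := by
    rw [glue_inter]
    exact Set.inter_eq_left.2 (Set.range_subset_iff.2 hx)
  rw [tsum_subtype _ (L.indicator f), Set.indicator_indicator, hset, ← tsum_subtype,
    tsum_range f hinj, tsum_fintype]

theorem count_glue {L : Set (Pt d)} {k : ℕ} {x : Fin k → Pt d} (hx : ∀ i, x i ∈ L)
    (hinj : Function.Injective x) (ω : Config d) :
    ((ofTuple x).restrict L ∪ ω.restrict Lᶜ).count L = k := by
  have hset : ((ofTuple x).restrict L ∪ ω.restrict Lᶜ).pts ∩ L = Set.range x := by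
    rw [glue_inter]
    exact Set.inter_eq_left.2 (Set.range_subset_iff.2 hx)
  rw [count, hset, ← Set.image_univ, Set.ncard_image_of_injective _ hinj, Set.ncard_univ,
    Nat.card_fin]

end Config

variable {H : Set (Pt d) → Config d → EReal} {L : Set (Pt d)}

theorem partitionFn_congr {k : ℕ} {ω ω' : Config d} (h : ω.restrict Lᶜ = ω'.restrict Lᶜ) :
    partitionFn H L k ω = partitionFn H L k ω' := by
  simp only [partitionFn, h]

theorem measurable_exp_neg (hHL : Measurable (H L)) :
    Measurable fun ω => EReal.exp (-(H L ω)) :=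
  EReal.measurable_exp.comp hHL.neg

theorem measurable_partitionFn (hL : BddBorel L) (hHL : Measurable (H L)) (k : ℕ) :
    Measurable (partitionFn H L k) := by
  have hm : Measurable fun p : Config d × (Fin k → Pt d) =>
      EReal.exp (-(H L ((Config.ofTuple p.2).restrict L ∪ p.1.restrict Lᶜ))) :=
    (measurable_exp_neg hHL).comp ((measurable_glue hL.2).comp
      (((Config.measurable_ofTuple k).comp measurable_snd).prodMk measurable_fst))
  convert! hm.lintegral_prod_right' (ν := lebPow L k) using 1
  funext ω
  refine lintegral_congr_ae ?_
  filter_upwards [ae_mem_lebPow hL.2 k] with x hx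
  rw [Config.restrict_ofTuple hx]

open Classical in
/-- The weight of `ω` when one point of `ω_L` out of `m + 1` is resampled: the reciprocal of the
partition function, times the number of choices of that point. -/
noncomputable def resamplingWeight (H : Set (Pt d) → Config d → EReal) (L : Set (Pt d)) (m : ℕ)
    (ω : Config d) : ℝ≥0∞ :=
  if ω.count L = m + 1 ∧ partitionFn H L (m + 1) ω ≠ 0 ∧ partitionFn H L (m + 1) ω ≠ ∞ then
    (m + 1) * (partitionFn H L (m + 1) ω)⁻¹
  else 0

theorem measurable_resamplingWeight (hL : BddBorel L) (hHL : Measurable (H L)) (m : ℕ) :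
    Measurable (resamplingWeight H L m) := by
  have hZ := measurable_partitionFn hL hHL (m + 1)
  refine Measurable.ite ?_ (measurable_const.mul hZ.inv) measurable_const
  exact (measurable_count hL (measurableSet_singleton _)).inter
    ((hZ (measurableSet_singleton 0).compl).inter (hZ (measurableSet_singleton ∞).compl))

/-- Inside one term of the DLR equation, the sum over the `m + 1` resampled points turns into
`m + 1` times an integral over a single point: the density is symmetric, and almost every tuple
is injective, so that removing the `j`-th point leaves the remaining `m` ones. -/
theorem lintegral_dlr_term (hd : 1 ≤ d) (hL : BddBorel L) (hHL : Measurable (H L))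
    {h : Pt d × Config d → ℝ≥0∞} (hh : Measurable h) (m : ℕ) (ω : Config d)
    [Decidable (ω.count L = m + 1)] :
    ∫⁻ x, (if ω.count L = m + 1 then 1 else 0) *
        (∑' y : (Config.ofTuple x ∪ ω.restrict Lᶜ).pts,
          L.indicator (fun y => h (y, (Config.ofTuple x ∪ ω.restrict Lᶜ).erase y)) y) *
        localDensity H L (m + 1) (Config.ofTuple x ∪ ω.restrict Lᶜ) ∂(lebPow L (m + 1)) =
      resamplingWeight H L m ω * ∫⁻ x, (∫⁻ y in L,
        h (y, (Config.ofTuple x).restrict L ∪ ω.restrict Lᶜ) *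
          EReal.exp (-(H L (((Config.ofTuple x).restrict L ∪ ω.restrict Lᶜ).insert y))))
          ∂(lebPow L m) := by
  classical
  set Z := partitionFn H L (m + 1) ω with hZ
  set T : (k : ℕ) → (Fin k → Pt d) → Config d :=
    fun k x => (Config.ofTuple x).restrict L ∪ ω.restrict Lᶜ with hT
  have hTm : ∀ k, Measurable (T k) := fun k =>
    (measurable_glue hL.2).comp ((Config.measurable_ofTuple k).prodMk measurable_const)
  set F : Fin (m + 1) → (Fin (m + 1) → Pt d) → ℝ≥0∞ := fun j x =>
    h (x j, (T (m + 1) x).erase (x j)) * EReal.exp (-(H L (T (m + 1) x))) with hF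
  have hFm : ∀ j, Measurable (F j) := fun j =>
    (hh.comp ((measurable_pi_apply j).prodMk
      (measurable_erase.comp ((measurable_pi_apply j).prodMk (hTm _))))).mul
      ((measurable_exp_neg hHL).comp (hTm _))
  have hFj : ∀ j, ∫⁻ x, F j x ∂(lebPow L (m + 1)) = ∫⁻ x, (∫⁻ y in L,
      h (y, T m x) * EReal.exp (-(H L ((T m x).insert y)))) ∂(lebPow L m) := by
    intro j
    have : Nonempty (Fin d) := ⟨⟨0, hd⟩⟩
    rw [lintegral_lebPow_succ L j (hFm j)]
    refine lintegral_congr fun x => lintegral_congr_ae ?_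
    have hnot : ∀ᵐ y : Pt d ∂(volume.restrict L), y ∉ (T m x).pts :=
      ((T m x).countable_pts.ae_notMem _)
    filter_upwards [ae_restrict_mem hL.2, hnot] with y hy hy'
    simp only [hF, Fin.insertNth_apply_same]
    have hins : T (m + 1) (Fin.insertNth j y x) = (T m x).insert y :=
      Config.insertNth_glue j hy x ω
    rw [hins, Config.erase_insert hy']
  by_cases hok : ω.count L = m + 1 ∧ Z ≠ 0 ∧ Z ≠ ∞
  · have hLHS : ∀ᵐ x ∂(lebPow L (m + 1)), (if ω.count L = m + 1 then 1 else 0) *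
        (∑' y : (Config.ofTuple x ∪ ω.restrict Lᶜ).pts,
          L.indicator (fun y => h (y, (Config.ofTuple x ∪ ω.restrict Lᶜ).erase y)) y) *
        localDensity H L (m + 1) (Config.ofTuple x ∪ ω.restrict Lᶜ) = Z⁻¹ * ∑ j, F j x := by
      filter_upwards [ae_mem_lebPow hL.2 (m + 1), ae_injective_lebPow hd L (m + 1)] with x hx hinj
      have hTx : Config.ofTuple x ∪ ω.restrict Lᶜ = T (m + 1) x := by
        simp only [hT, Config.restrict_ofTuple hx]
      have hpart : partitionFn H L (m + 1) (T (m + 1) x) = Z :=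
        partitionFn_congr (Config.glue_restrict_compl _ _ _)
      rw [hTx, if_pos hok.1, one_mul, localDensity, hpart,
        if_pos ⟨Config.count_glue hx hinj ω, hok.2⟩, Config.tsum_glue hx hinj ω, hF,
        ← Finset.sum_mul, ENNReal.div_eq_inv_mul]
      ring
    rw [lintegral_congr_ae hLHS, lintegral_const_mul _ (Finset.measurable_sum _ fun j _ => hFm j),
      lintegral_finsetSum _ fun j _ => hFm j, Finset.sum_congr rfl fun j _ => hFj j,
      Finset.sum_const, resamplingWeight, if_pos hok, Finset.card_univ, Fintype.card_fin,
      nsmul_eq_mul]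
    push_cast
    ring
  · rw [resamplingWeight, if_neg hok, zero_mul, lintegral_eq_zero_of_ae_eq_zero]
    filter_upwards [ae_mem_lebPow hL.2 (m + 1)] with x hx
    have hTx : Config.ofTuple x ∪ ω.restrict Lᶜ = T (m + 1) x := by
      simp only [hT, Config.restrict_ofTuple hx]
    have hpart : partitionFn H L (m + 1) (T (m + 1) x) = Z :=
      partitionFn_congr (Config.glue_restrict_compl _ _ _)
    rw [hTx]
    by_cases hc : ω.count L = m + 1
    · rw [localDensity, hpart, if_neg fun hc' : _ ∧ Z ≠ 0 ∧ Z ≠ ∞ => hok ⟨hc, hc'.2⟩,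
        mul_zero]
      rfl
    · rw [if_neg hc, zero_mul, zero_mul]
      rfl

/-- Disintegration of the reduced Campbell measure of a canonical Gibbs measure over a bounded
Borel set `L`: for some measure `M` on configurations it has density
`e^{-H_L(η ∪ y)}` with respect to `dy ⊗ M(dη)` on `L`. To build `M`, replace the `m + 1` points of
`ω` in `L` by `m` points with law `dx_1 ⋯ dx_m`, weighted with `resamplingWeight H L m ω`. -/
theorem IsCanonicalGibbs.exists_campbell_disintegration (hd : 1 ≤ d) {P : Measure (Config d)}
    (hP : IsCanonicalGibbs H P) (hL : BddBorel L) (hHL : Measurable (H L)) :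
    ∃ M : Measure (Config d), ∀ h : Pt d × Config d → ℝ≥0∞, Measurable h →
      ∫⁻ ω, ∑' x : ω.pts, L.indicator (fun y => h (y, ω.erase y)) x ∂P =
        ∫⁻ η, (∫⁻ y in L, h (y, η) * EReal.exp (-(H L (η.insert y)))) ∂M := by
  classical
  have := hP.isProbabilityMeasure
  have hgl : ∀ m, Measurable fun p : Config d × (Fin m → Pt d) =>
      (Config.ofTuple p.2).restrict L ∪ p.1.restrict Lᶜ := fun m =>
    (measurable_glue hL.2).comp
      (((Config.measurable_ofTuple m).comp measurable_snd).prodMk measurable_fst)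
  have hw : ∀ m, Measurable fun p : Config d × (Fin m → Pt d) => resamplingWeight H L m p.1 :=
    fun m => (measurable_resamplingWeight hL hHL m).comp measurable_fst
  refine ⟨Measure.sum fun m => ((P.prod (lebPow L m)).withDensity fun p =>
    resamplingWeight H L m p.1).map
      fun p => (Config.ofTuple p.2).restrict L ∪ p.1.restrict Lᶜ, fun h hh => ?_⟩
  have hG : Measurable fun η : Config d =>
      ∫⁻ y in L, h (y, η) * EReal.exp (-(H L (η.insert y))) :=
    (hh.mul ((measurable_exp_neg hHL).comp measurable_insert)).lintegral_prod_left'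
  have hS : Measurable fun ω : Config d =>
      ∑' x : ω.pts, L.indicator (fun y => h (y, ω.erase y)) x := by
    have hh' : Measurable ((L ×ˢ Set.univ).indicator h) :=
      hh.indicator (hL.2.prod MeasurableSet.univ)
    convert! measurable_tsum_erase hh' using 1
    funext ω
    refine tsum_congr fun x => ?_
    by_cases hx : (x : Pt d) ∈ L <;> simp [hx]
  rw [hP.dlr L hL _ hS, tsum_eq_zero_add' ENNReal.summable, lintegral_sum_measure]
  have h0 : ∀ (ω : Config d) (x : Fin 0 → Pt d),
      ∑' y : (Config.ofTuple x ∪ ω.restrict Lᶜ).pts,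
        L.indicator (fun y => h (y, (Config.ofTuple x ∪ ω.restrict Lᶜ).erase y)) y = 0 := by
    intro ω x
    have hx : ∀ i : Fin 0, x i ∈ L := fun i => i.elim0
    have := Config.tsum_glue hx (Function.injective_of_subsingleton x) ω
      (fun y => h (y, (Config.ofTuple x ∪ ω.restrict Lᶜ).erase y))
    rwa [Config.restrict_ofTuple hx, Finset.univ_eq_empty, Finset.sum_empty] at this
  simp only [h0, mul_zero, zero_mul, lintegral_zero, zero_add]
  refine tsum_congr fun m => ?_
  rw [lintegral_map hG (hgl m)]
  refine Eq.trans ?_ ((lintegral_withDensity_eq_lintegral_mul _ (hw m)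
    (hG.comp (hgl m))).trans (lintegral_prod _ ((hw m).mul (hG.comp (hgl m))).aemeasurable)).symm
  refine lintegral_congr fun ω => ?_
  rw [lintegral_dlr_term hd hL hHL hh m ω]
  have hGω : Measurable fun x : Fin m → Pt d =>
      ∫⁻ y in L, h (y, (Config.ofTuple x).restrict L ∪ ω.restrict Lᶜ) *
        EReal.exp (-(H L (((Config.ofTuple x).restrict L ∪ ω.restrict Lᶜ).insert y))) :=
    hG.comp ((hgl m).comp measurable_prodMk_left)
  rw [← lintegral_const_mul _ hGω]
  rfl

/-! ### Translations and insertions -/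

namespace Config

theorem insert_restrict_compl (η : Config d) {y : Pt d} {L : Set (Pt d)} (hy : y ∈ L) :
    (η.insert y).restrict Lᶜ = η.restrict Lᶜ := by
  ext z
  show (z = y ∨ z ∈ η.pts) ∧ z ∉ L ↔ z ∈ η.pts ∧ z ∉ L
  refine ⟨?_, fun h => ⟨Or.inr h.1, h.2⟩⟩
  rintro ⟨rfl | hz, hL⟩
  · exact absurd hy hL
  · exact ⟨hz, hL⟩

theorem mem_shift {ω : Config d} {u x : Pt d} : x ∈ (ω.shift u).pts ↔ x - u ∈ ω.pts := by
  constructor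
  · rintro ⟨z, hz, rfl⟩
    simpa using hz
  · exact fun h => ⟨x - u, h, by simp⟩

theorem shift_shift (ω : Config d) (u v : Pt d) : (ω.shift u).shift v = ω.shift (u + v) := by
  ext x
  rw [mem_shift, mem_shift, mem_shift, sub_sub, add_comm v u]

theorem shift_zero (ω : Config d) : ω.shift 0 = ω := by
  ext x
  rw [mem_shift, sub_zero]

theorem shift_neg_shift (ω : Config d) (u : Pt d) : (ω.shift u).shift (-u) = ω := by
  rw [shift_shift, add_neg_cancel, shift_zero]

theorem insert_shift (ω : Config d) (u y : Pt d) :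
    (ω.shift u).insert y = (ω.insert (y - u)).shift u := by
  ext x
  rw [mem_shift]
  show x = y ∨ x ∈ (ω.shift u).pts ↔ x - u = y - u ∨ x - u ∈ ω.pts
  rw [mem_shift, sub_left_inj]

end Config

/-! ### Cubes -/

theorem isClosed_cube (a : ℝ) : IsClosed (cube d a) := by
  simp only [cube, Set.ofPred_forall]
  exact isClosed_iInter fun i => isClosed_Icc.preimage (EuclideanSpace.proj i).continuous

theorem bddBorel_cube (a : ℝ) : BddBorel (cube d a) := by
  refine ⟨?_, (isClosed_cube a).measurableSet⟩
  have h : IsCompact (WithLp.toLp 2 '' (Set.univ.pi fun _ : Fin d => Set.Icc (-a) a)) :=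
    (isCompact_univ_pi fun _ => isCompact_Icc).image (PiLp.continuous_toLp 2 _)
  exact h.isBounded.subset fun x hx => ⟨x.ofLp, fun i _ => hx i, rfl⟩

theorem cube_mem_nhds {a : ℝ} {y : Pt d} (hy : ∀ i, y i ∈ Set.Ioo (-a) a) : cube d a ∈ 𝓝 y := by
  have ho : IsOpen {x : Pt d | ∀ i, x i ∈ Set.Ioo (-a) a} := by
    simp only [Set.ofPred_forall]
    exact isOpen_iInter_of_finite fun i => isOpen_Ioo.preimage (EuclideanSpace.proj i).continuous
  exact mem_of_superset (ho.mem_nhds hy) fun x hx i => Set.Ioo_subset_Icc_self (hx i)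

theorem exists_subset_cube {L : Set (Pt d)} (hL : Bornology.IsBounded L) :
    ∃ n : ℕ, L ⊆ cube d n := by
  obtain ⟨R, hR⟩ := hL.exists_norm_le
  obtain ⟨n, hn⟩ := exists_nat_ge R
  refine ⟨n, fun x hx i => ?_⟩
  have h := (PiLp.norm_apply_le x i).trans ((hR x hx).trans hn)
  rw [Real.norm_eq_abs, abs_le] at h
  exact h

/-! ### Gradients of the energies -/

theorem IsEnergyFamily.ne_top_of_subset (hH : IsEnergyFamily H) {L L' : Set (Pt d)}
    (hL : BddBorel L) (hL' : BddBorel L') (hLL' : L ⊆ L') {ω : Config d} (h : H L' ω ≠ ⊤) :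
    H L ω ≠ ⊤ := by
  obtain ⟨φ, -, hφ, hφH⟩ := hH.compatible L L' hL hL' hLL'
  rw [hφH, EReal.add_ne_top_iff_ne_top₂ (hH.ne_bot L hL ω) (hφ _)] at h
  exact h.1

theorem IsEnergyFamily.measurableSet_finiteEnergy (hH : IsEnergyFamily H) :
    MeasurableSet (finiteEnergy H) := by
  have heq : finiteEnergy H = ⋂ n : ℕ, {ω | H (cube d n) ω ≠ ⊤} := by
    ext ω
    simp only [finiteEnergy, Set.mem_ofPred_eq, Set.mem_iInter]
    refine ⟨fun h n => h _ (bddBorel_cube _), fun h L hL => ?_⟩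
    obtain ⟨n, hn⟩ := exists_subset_cube hL.1
    exact hH.ne_top_of_subset hL (bddBorel_cube _) hn (h n)
  rw [heq]
  exact MeasurableSet.iInter fun n =>
    hH.measurable _ (bddBorel_cube _) (measurableSet_singleton ⊤).compl

/-- Where the energy in a neighbourhood `L` of `y` is finite, it has the gradient `v` as soon as
the energy in some other neighbourhood does: both differ from the energy in the intersection of
the neighbourhoods by constants, which are finite. -/
theorem IsEnergyFamily.hasGradientAt_of_hasEnergyGradient (hH : IsEnergyFamily H)
    {L : Set (Pt d)} (hL : BddBorel L) {y v : Pt d} {η : Config d} (hy : L ∈ 𝓝 y)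
    (hfin : H L (η.insert y) ≠ ⊤) (hv : HasEnergyGradient H y η v) :
    (∀ᶠ x in 𝓝 y, H L (η.insert x) ≠ ⊤) ∧
      HasGradientAt (fun x => (H L (η.insert x)).toReal) v y := by
  obtain ⟨-, L₁, hL₁, hy₁, hfin₁, hgrad⟩ := hv
  have hL₂ : BddBorel (L₁ ∩ L) := ⟨hL₁.1.subset Set.inter_subset_left, hL₁.2.inter hL.2⟩
  obtain ⟨φ, -, hφ, hφH⟩ := hH.compatible (L₁ ∩ L) L hL₂ hL Set.inter_subset_right
  obtain ⟨φ₁, -, hφ₁, hφH₁⟩ := hH.compatible (L₁ ∩ L) L₁ hL₂ hL₁ Set.inter_subset_left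
  have hy₂ : L₁ ∩ L ∈ 𝓝 y := inter_mem hy₁ hy
  set c := φ (η.restrict (L₁ ∩ L)ᶜ) with hc
  set c₁ := φ₁ (η.restrict (L₁ ∩ L)ᶜ) with hc₁
  have hcb : c ≠ ⊥ := hφ _
  have hcb₁ : c₁ ≠ ⊥ := hφ₁ _
  have hE : ∀ x ∈ L₁ ∩ L, H L (η.insert x) = H (L₁ ∩ L) (η.insert x) + c := fun x hx => by
    rw [hφH, Config.insert_restrict_compl η hx]
  have hE₁ : ∀ x ∈ L₁ ∩ L, H L₁ (η.insert x) = H (L₁ ∩ L) (η.insert x) + c₁ := fun x hx => by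
    rw [hφH₁, Config.insert_restrict_compl η hx]
  have hb : ∀ x, H (L₁ ∩ L) (η.insert x) ≠ ⊥ := fun x => hH.ne_bot _ hL₂ _
  have hct : c ≠ ⊤ := by
    rw [hE y (mem_of_mem_nhds hy₂), EReal.add_ne_top_iff_ne_top₂ (hb y) hcb] at hfin
    exact hfin.2
  have hct₁ : c₁ ≠ ⊤ := by
    have h := hfin₁.self_of_nhds
    rw [hE₁ y (mem_of_mem_nhds hy₂), EReal.add_ne_top_iff_ne_top₂ (hb y) hcb₁] at h
    exact h.2
  have hfin₂ : ∀ᶠ x in 𝓝 y, H (L₁ ∩ L) (η.insert x) ≠ ⊤ := by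
    filter_upwards [hfin₁, hy₂] with x hx hx₂
    rw [hE₁ x hx₂, EReal.add_ne_top_iff_ne_top₂ (hb x) hcb₁] at hx
    exact hx.1
  constructor
  · filter_upwards [hfin₂, hy₂] with x hx hx₂
    rw [hE x hx₂]
    exact EReal.add_ne_top hx hct
  · rw [hasGradientAt_iff_hasFDerivAt] at hgrad ⊢
    refine (hgrad.add_const (c.toReal - c₁.toReal)).congr_of_eventuallyEq ?_
    filter_upwards [hfin₂, hy₂] with x hx hx₂
    rw [hE x hx₂, hE₁ x hx₂, EReal.toReal_add hx (hb x) hct hcb,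
      EReal.toReal_add hx (hb x) hct₁ hcb₁]
    ring

/-- At configurations of locally finite energy the second alternative in the differentiability
of the energies, infinite energy near the point, is impossible. -/
theorem EnergyDifferentiableAt.hasEnergyGradient_gradH {y : Pt d} {η : Config d}
    (h : EnergyDifferentiableAt H y η) (hfin : η.insert y ∈ finiteEnergy H) :
    HasEnergyGradient H y η (gradH H y η) := by
  rcases h with h | ⟨-, L, hL, -, hinf⟩
  · rw [gradH, dif_pos h]
    exact h.choose_spec
  · exact absurd hinf.self_of_nhds (hfin L hL)

/-! ### Translation invariance of gradients -/

theorem _root_.HasGradientAt.comp_sub_const {f : Pt d → ℝ} {v x : Pt d}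
    (h : HasGradientAt f v x) (u : Pt d) : HasGradientAt (fun y => f (y - u)) v (x + u) := by
  rw [hasGradientAt_iff_hasFDerivAt] at h ⊢
  rw [← add_sub_cancel_right x u] at h
  exact (hasFDerivAt_comp_sub u).2 h

theorem IsShiftInvariantFamily.hasEnergyGradient_shift (hH : IsShiftInvariantFamily H)
    {x v : Pt d} {ω : Config d} (h : HasEnergyGradient H x ω v) (u : Pt d) :
    HasEnergyGradient H (x + u) (ω.shift u) v := by
  obtain ⟨hx, L, hL, hxL, hfin, hgrad⟩ := h
  have hpre : (fun x => x + u) '' L = (fun x => x - u) ⁻¹' L := by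
    ext z
    constructor
    · rintro ⟨y, hy, rfl⟩
      simpa using hy
    · exact fun hz => ⟨z - u, hz, by simp⟩
  have htend : Tendsto (fun y : Pt d => y - u) (𝓝 (x + u)) (𝓝 x) := by
    have := (continuous_sub_right u).tendsto (x + u)
    rwa [add_sub_cancel_right] at this
  have hE : ∀ y, H ((fun x => x + u) '' L) ((ω.shift u).insert y) = H L (ω.insert (y - u)) := by
    intro y
    rw [Config.insert_shift, ← hH u _ L hL]
  refine ⟨?_, (fun x => x + u) '' L, ⟨?_, ?_⟩, ?_, ?_, ?_⟩
  · rwa [Config.mem_shift, add_sub_cancel_right]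
  · exact (isometry_add_right u).lipschitz.isBounded_image hL.1
  · rw [hpre]
    exact (measurable_id.sub_const u) hL.2
  · rw [hpre]
    exact htend hxL
  · simp only [hE]
    exact htend.eventually hfin
  · simp only [hE]
    exact hgrad.comp_sub_const u

theorem IsShiftInvariantFamily.gradH_shift (hH : IsShiftInvariantFamily H) (u x : Pt d)
    (ω : Config d) : gradH H (x + u) (ω.shift u) = gradH H x ω := by
  classical
  have h : (fun v => HasEnergyGradient H (x + u) (ω.shift u) v) =
      fun v => HasEnergyGradient H x ω v := by
    funext v
    refine propext ⟨fun h => ?_, fun h => hH.hasEnergyGradient_shift h u⟩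
    have := hH.hasEnergyGradient_shift h (-u)
    rwa [Config.shift_neg_shift, add_neg_cancel_right] at this
  have hcongr : ∀ {p q : Pt d → Prop}, p = q →
      (if h : ∃ v, p v then h.choose else 0) = if h : ∃ v, q v then h.choose else 0 := by
    rintro p _ rfl
    rfl
  exact hcongr h

theorem gradient_shift {g : Pt d → Config d → ℝ}
    (hg : ∀ u x ω, g (x + u) (ω.shift u) = g x ω) (u x : Pt d) (ω : Config d) :
    gradient (fun y => g y (ω.shift u)) (x + u) = gradient (fun y => g y ω) x := by
  have h : (fun y => g y (ω.shift u)) = fun y => g (y - u) ω := by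
    funext y
    rw [← hg u (y - u) ω, sub_add_cancel]
  rw [h, gradient, gradient, fderiv_comp_sub (f := fun y => g y ω), add_sub_cancel_right]

/-! ### Integration by parts in a cube -/

/-- The derivative of a function vanishes almost everywhere on its zero set: all but countably many
points of that set are limits of other points of it. -/
theorem ae_deriv_eq_zero_of_eq_zero (u : ℝ → ℝ) : ∀ᵐ t, u t = 0 → deriv u t = 0 := by
  have hc := (countable_setOfPred_isolated_right_within (s := {t | u t = 0})).ae_notMem
    (volume : Measure ℝ)
  filter_upwards [hc] with t ht h0
  by_cases hd : DifferentiableAt ℝ u t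
  swap
  · exact deriv_zero_of_not_differentiableAt hd
  have hne : (𝓝[{t | u t = 0} ∩ Set.Ioi t] t).NeBot := ⟨fun hbot => ht ⟨h0, hbot⟩⟩
  have hs := hd.hasDerivAt.tendsto_slope.mono_left
    (nhdsWithin_mono t (fun s hs => (ne_of_gt hs.2 : s ≠ t)) :
      𝓝[{t | u t = 0} ∩ Set.Ioi t] t ≤ 𝓝[≠] t)
  refine tendsto_nhds_unique hs (tendsto_const_nhds.congr' ?_)
  filter_upwards [self_mem_nhdsWithin] with s hs
  have hs0 : u s = 0 := hs.1
  simp [slope_def_field, hs0, h0]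

/-- Integration by parts of an absolutely continuous function against the cutoff `1 - t²`, which
vanishes at both ends of the interval. -/
theorem integral_cutoff_eq_zero {u : ℝ → ℝ} (hu : AbsolutelyContinuousOnInterval u (-1) 1) :
    ∫ t in (-1 : ℝ)..1, (-(2 * t) * u t + (1 - t ^ 2) * deriv u t) = 0 := by
  have hψ : AbsolutelyContinuousOnInterval (fun t : ℝ => 1 - t ^ 2) (-1) 1 := by
    apply ContDiffOn.absolutelyContinuousOnInterval
    fun_prop
  have hd : ∀ t : ℝ, deriv (fun t : ℝ => 1 - t ^ 2) t = -(2 * t) := fun t => by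
    simp
  have h := hψ.integral_deriv_mul_eq_sub hu
  simp only [hd] at h
  rw [h]
  norm_num

theorem linePoint_apply_self (i : Fin d) (y : {j : Fin d // j ≠ i} → ℝ) (t : ℝ) :
    linePoint i y t i = t := by
  simp [linePoint]

theorem linePoint_apply_ne (i : Fin d) (y : {j : Fin d // j ≠ i} → ℝ) (t : ℝ)
    (j : {j : Fin d // j ≠ i}) : linePoint i y t j = y j := by
  simp [linePoint, j.2]

theorem forall_linePoint {i : Fin d} {y : {j : Fin d // j ≠ i} → ℝ} {t : ℝ} {p : ℝ → Prop} :
    (∀ j, p (linePoint i y t j)) ↔ (∀ j, p (y j)) ∧ p t := by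
  constructor
  · intro h
    refine ⟨fun j => ?_, ?_⟩
    · rw [← linePoint_apply_ne i y t j]; exact h j
    · have := h i
      rwa [linePoint_apply_self] at this
  · rintro ⟨h, ht⟩ j
    by_cases hj : j = i
    · subst hj
      rwa [linePoint_apply_self]
    · rw [linePoint_apply_ne i y t ⟨j, hj⟩]; exact h ⟨j, hj⟩

theorem hasDerivAt_linePoint (i : Fin d) (y : {j : Fin d // j ≠ i} → ℝ) (t : ℝ) :
    HasDerivAt (linePoint i y) (EuclideanSpace.single i (1 : ℝ)) t := by
  have h : linePoint i y = fun s => linePoint i y 0 + s • EuclideanSpace.single i (1 : ℝ) := by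
    funext s
    ext j
    by_cases hj : j = i
    · subst hj
      simp [linePoint]
    · simp [linePoint, hj]
  rw [h]
  simpa using ((hasDerivAt_id t).smul_const (EuclideanSpace.single i (1 : ℝ))).const_add
    (linePoint i y 0)

theorem _root_.HasGradientAt.hasDerivAt_linePoint {f : Pt d → ℝ} {v : Pt d} {i : Fin d}
    {y : {j : Fin d // j ≠ i} → ℝ} {t : ℝ} (h : HasGradientAt f v (linePoint i y t)) :
    HasDerivAt (fun s => f (linePoint i y s)) (v i) t := by
  have := h.hasFDerivAt.comp_hasDerivAt t (PointProcess.hasDerivAt_linePoint i y t)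
  rw [InnerProductSpace.toDual_apply_apply, EuclideanSpace.inner_single_right] at this
  simpa using! this

instance uniqueSubtypeNotNe (i : Fin d) : Unique {j : Fin d // ¬ j ≠ i} :=
  ⟨⟨⟨i, not_not.2 rfl⟩⟩, fun j => Subtype.ext (not_not.1 j.2)⟩

/-- Splitting off the `i`-th coordinate of a point, in the form `(y, t) ↦ linePoint i y t`. -/
noncomputable def linePointEquiv (i : Fin d) : ({j : Fin d // j ≠ i} → ℝ) × ℝ ≃ᵐ Pt d :=
  ((MeasurableEquiv.refl _).prodCongr
      (MeasurableEquiv.funUnique {j : Fin d // ¬ j ≠ i} ℝ).symm).trans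
    ((MeasurableEquiv.piEquivPiSubtypeProd (fun _ : Fin d => ℝ) fun j => j ≠ i).symm.trans
      (MeasurableEquiv.toLp 2 (Fin d → ℝ)))

theorem linePointEquiv_apply (i : Fin d) (q : ({j : Fin d // j ≠ i} → ℝ) × ℝ) :
    linePointEquiv i q = linePoint i q.1 q.2 := by
  ext j
  by_cases hj : j = i
  · simp [linePointEquiv, linePoint, hj]
    rfl
  · simp [linePointEquiv, linePoint, hj]
    rfl

theorem measurePreserving_linePointEquiv (i : Fin d) :
    MeasurePreserving (linePointEquiv i) (volume.prod volume) volume := by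
  have h0 : MeasurePreserving (MeasurableEquiv.funUnique {j : Fin d // ¬ j ≠ i} ℝ).symm
      volume volume := by
    convert! (volume_preserving_funUnique {j : Fin d // ¬ j ≠ i} ℝ).symm
  have h1 : MeasurePreserving ((MeasurableEquiv.refl ({j : Fin d // j ≠ i} → ℝ)).prodCongr
      (MeasurableEquiv.funUnique {j : Fin d // ¬ j ≠ i} ℝ).symm)
      (volume.prod volume) (volume.prod volume) :=
    (MeasurePreserving.id volume).prod h0
  have h2 : MeasurePreserving
      (MeasurableEquiv.piEquivPiSubtypeProd (fun _ : Fin d => ℝ) fun j => j ≠ i).symm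
      (volume.prod volume) volume :=
    (volume_preserving_piEquivPiSubtypeProd (fun _ : Fin d => ℝ) fun j => j ≠ i).symm
  exact ((PiLp.volume_preserving_toLp (Fin d)).comp h2).comp h1

theorem linePoint_mem_cube {i : Fin d} {a : ℝ} {y : {j : Fin d // j ≠ i} → ℝ} {t : ℝ} :
    linePoint i y t ∈ cube d a ↔
      (∀ j, y j ∈ Set.Icc (-a) a) ∧ t ∈ Set.Icc (-a) a :=
  forall_linePoint (p := fun s => s ∈ Set.Icc (-a) a)

theorem exp_neg_eq_ofReal {x : EReal} (hx : x ≠ ⊤) (hx' : x ≠ ⊥) :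
    EReal.exp (-x) = ENNReal.ofReal (Real.exp (-x.toReal)) := by
  lift x to ℝ using ⟨hx, hx'⟩
  rw [← EReal.coe_neg, EReal.exp_coe, EReal.toReal_coe]

/-- Integration by parts over the cube `[-1, 1]^d` in direction `i`, for the weight `e^{-E}` and
with the cutoff `1 - p_i²`. There is no boundary term because the cutoff vanishes on the two faces
orthogonal to the direction `i`. Differentiability is only needed where the weight is positive. -/
theorem integral_cube_eq_zero {G : Pt d → ℝ} {E : Pt d → EReal} {Φ : Pt d → ℝ} (i : Fin d)
    (hE : ∀ p, E p ≠ ⊥)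
    (hAC : ∀ᵐ y : {j : Fin d // j ≠ i} → ℝ, (∀ j, y j ∈ Set.Icc (-1 : ℝ) 1) →
      AbsolutelyContinuousOnInterval
        (fun t => G (linePoint i y t) * (EReal.exp (-(E (linePoint i y t)))).toReal) (-1) 1)
    (hΦ : ∀ᵐ p, (∀ j, p j ∈ Set.Ioo (-1 : ℝ) 1) → E p ≠ ⊤ → ∃ a v : Pt d,
      HasGradientAt G a p ∧ (∀ᶠ x in 𝓝 p, E x ≠ ⊤) ∧
      HasGradientAt (fun x => (E x).toReal) v p ∧
      Φ p = (1 - p i ^ 2) * (a i - G p * v i) - 2 * p i * G p)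
    (hint : IntegrableOn (fun p => Φ p * (EReal.exp (-(E p))).toReal) (cube d 1)) :
    ∫ p in cube d 1, Φ p * (EReal.exp (-(E p))).toReal = 0 := by
  have hmp := measurePreserving_linePointEquiv i
  have hpre : linePointEquiv i ⁻¹' cube d 1 =
      {y | ∀ j, y j ∈ Set.Icc (-1 : ℝ) 1} ×ˢ Set.Icc (-1 : ℝ) 1 := by
    ext q
    rw [Set.mem_preimage, linePointEquiv_apply, linePoint_mem_cube, Set.mem_prod]
    rfl
  rw [← hmp.setIntegral_preimage_emb (linePointEquiv i).measurableEmbedding]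
  have hint' := (hmp.integrableOn_comp_preimage (linePointEquiv i).measurableEmbedding).2 hint
  rw [hpre] at hint' ⊢
  refine (setIntegral_prod _ hint').trans ?_
  have hpos : ∀ᵐ y : {j : Fin d // j ≠ i} → ℝ, ∀ j, y j ≠ -1 ∧ y j ≠ 1 := by
    refine ae_all_iff.2 fun j => ?_
    have h1 : ∀ᵐ s : ℝ, s ≠ -1 ∧ s ≠ 1 := by
      filter_upwards [(Set.countable_singleton (-1 : ℝ)).ae_notMem volume,
        (Set.countable_singleton (1 : ℝ)).ae_notMem volume] with s hs hs' using ⟨hs, hs'⟩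
    exact (Measure.tendsto_eval_ae_ae (μ := fun _ : {j : Fin d // j ≠ i} => (volume : Measure ℝ))
      (i := j)).eventually h1
  have hlines := Measure.ae_ae_of_ae_prod (hmp.quasiMeasurePreserving.ae hΦ)
  rw [← integral_zero ({j : Fin d // j ≠ i} → ℝ) ℝ]
  have hms : MeasurableSet {y : {j : Fin d // j ≠ i} → ℝ | ∀ j, y j ∈ Set.Icc (-1 : ℝ) 1} := by
    simp only [Set.ofPred_forall]
    exact MeasurableSet.iInter fun j => measurable_pi_apply j measurableSet_Icc
  rw [← integral_indicator hms]
  refine integral_congr_ae ?_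
  filter_upwards [hAC, hpos, hlines] with y hACy hposy hy
  by_cases hmem : ∀ j, y j ∈ Set.Icc (-1 : ℝ) 1
  swap
  · exact Set.indicator_of_notMem (s := {y : {j : Fin d // j ≠ i} → ℝ |
      ∀ j, y j ∈ Set.Icc (-1 : ℝ) 1}) hmem _
  rw [Set.indicator_of_mem (show y ∈ {y : {j : Fin d // j ≠ i} → ℝ |
    ∀ j, y j ∈ Set.Icc (-1 : ℝ) 1} from hmem)]
  have hu := hACy hmem
  set u : ℝ → ℝ :=
    fun t => G (linePoint i y t) * (EReal.exp (-(E (linePoint i y t)))).toReal with hu_def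
  rw [integral_Icc_eq_integral_Ioc, ← intervalIntegral.integral_of_le (by norm_num),
    ← integral_cutoff_eq_zero hu]
  refine intervalIntegral.integral_congr_ae ?_
  have hne : ∀ᵐ t : ℝ, t ≠ 1 := (Set.countable_singleton (1 : ℝ)).ae_notMem volume
  filter_upwards [hy, ae_deriv_eq_zero_of_eq_zero u, hne] with t ht hderiv ht1 htI
  rw [Set.uIoc_of_le (by norm_num)] at htI
  rw [linePointEquiv_apply] at ht
  rw [Function.comp_apply, linePointEquiv_apply]
  simp only at ht ⊢
  set p := linePoint i y t with hp
  have hpi : p i = t := linePoint_apply_self i y t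
  have hp_mem : ∀ j, p j ∈ Set.Ioo (-1 : ℝ) 1 :=
    (forall_linePoint (p := fun s => s ∈ Set.Ioo (-1 : ℝ) 1)).2
      ⟨fun j => ⟨(hmem j).1.lt_of_ne' (hposy j).1, (hmem j).2.lt_of_ne (hposy j).2⟩,
        htI.1, htI.2.lt_of_ne ht1⟩
  by_cases hEp : E p = ⊤
  · have hu0 : u t = 0 := by simp [hu_def, ← hp, hEp]
    rw [hderiv hu0, hu0, hEp]
    simp
  obtain ⟨a, v, ha, hfin, hv, hΦp⟩ := ht hp_mem hEp
  have hweight : ∀ x, E x ≠ ⊤ → (EReal.exp (-(E x))).toReal = Real.exp (-(E x).toReal) := by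
    intro x hx
    rw [exp_neg_eq_ofReal hx (hE x), ENNReal.toReal_ofReal (Real.exp_pos _).le]
  have htend : Tendsto (linePoint i y) (𝓝 t) (𝓝 p) :=
    (hasDerivAt_linePoint i y t).continuousAt
  have hder : HasDerivAt u ((a i - G p * v i) * Real.exp (-(E p).toReal)) t := by
    have h := ha.hasDerivAt_linePoint.mul hv.hasDerivAt_linePoint.neg.exp
    refine HasDerivAt.congr_of_eventuallyEq (h.congr_deriv ?_) ?_
    · rw [← hp]
      simp only [Pi.neg_apply, ← hp]
      ring
    · filter_upwards [htend.eventually hfin] with s hs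
      simp only [hu_def, hweight _ hs]
      rfl
  rw [hder.deriv, hΦp, hweight p hEp, hpi]
  simp only [hu_def, ← hp, hweight p hEp]
  ring

/-! ### From environments to the Palm measure -/

theorem ofReal_mul_toReal {a : ℝ} {w : ℝ≥0∞} (hw : w ≠ ∞) :
    ENNReal.ofReal (a * w.toReal) = ENNReal.ofReal a * w := by
  rw [ENNReal.ofReal_mul' ENNReal.toReal_nonneg, ENNReal.ofReal_toReal hw]

theorem integrable_mul_toReal {α : Type*} [MeasurableSpace α] {μ : Measure α} {φ : α → ℝ}
    {w : α → ℝ≥0∞} (hφ : Measurable φ) (hw : Measurable w) (hw_top : ∀ x, w x ≠ ∞)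
    (hpos : ∫⁻ x, ENNReal.ofReal (φ x) * w x ∂μ < ∞)
    (hneg : ∫⁻ x, ENNReal.ofReal (-φ x) * w x ∂μ < ∞) :
    Integrable (fun x => φ x * (w x).toReal) μ := by
  refine ⟨(hφ.mul hw.ennreal_toReal).aestronglyMeasurable, ?_⟩
  rw [hasFiniteIntegral_iff_norm]
  have heq : ∀ x, ENNReal.ofReal ‖φ x * (w x).toReal‖ =
      ENNReal.ofReal (φ x) * w x + ENNReal.ofReal (-φ x) * w x := by
    intro x
    rw [norm_mul, Real.norm_of_nonneg ENNReal.toReal_nonneg, ofReal_mul_toReal (hw_top x),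
      ← add_mul, Real.norm_eq_abs]
    rcases le_total 0 (φ x) with h | h
    · rw [abs_of_nonneg h, ENNReal.ofReal_of_nonpos (neg_nonpos.2 h), add_zero]
    · rw [abs_of_nonpos h, ENNReal.ofReal_of_nonpos h, zero_add]
  simp only [heq]
  exact (lintegral_add_left (hφ.ennreal_ofReal.mul hw) _).trans_lt
    (ENNReal.add_lt_top.2 ⟨hpos, hneg⟩)

theorem lintegral_pos_eq_neg_of_integral_eq_zero {α : Type*} [MeasurableSpace α] {μ : Measure α}
    {f : α → ℝ} (hf : Integrable f μ) (h0 : ∫ x, f x ∂μ = 0) :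
    ∫⁻ x, ENNReal.ofReal (f x) ∂μ = ∫⁻ x, ENNReal.ofReal (-f x) ∂μ := by
  rw [integral_eq_lintegral_pos_part_sub_lintegral_neg_part hf, sub_eq_zero] at h0
  exact (ENNReal.toReal_eq_toReal_iff' hf.lintegral_lt_top.ne hf.neg.lintegral_lt_top.ne).1 h0

theorem ae_notMem_of_lintegral_eq_zero {M : Measure (Config d)} {L : Set (Pt d)}
    {E : Pt d × Config d → EReal} (hE : Measurable E) {B : Set (Pt d × Config d)}
    (hB : MeasurableSet B)
    (h0 : ∫⁻ η, (∫⁻ y in L, B.indicator 1 (y, η) * EReal.exp (-(E (y, η)))) ∂M = 0) :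
    ∀ᵐ η ∂M, ∀ᵐ y ∂(volume.restrict L), E (y, η) ≠ ⊤ → (y, η) ∉ B := by
  have hm : Measurable fun p => B.indicator 1 p * EReal.exp (-(E p)) :=
    (measurable_one.indicator hB).mul (EReal.measurable_exp.comp hE.neg)
  rw [lintegral_eq_zero_iff hm.lintegral_prod_left'] at h0
  filter_upwards [h0] with η hη
  have hη' := (lintegral_eq_zero_iff (hm.comp measurable_prodMk_right)).1 hη
  filter_upwards [hη'] with y hy hEy hyB
  have hy' : B.indicator (1 : Pt d × Config d → ℝ≥0∞) (y, η) * EReal.exp (-(E (y, η))) = 0 := hy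
  rw [Set.indicator_of_mem hyB, Pi.one_apply, one_mul, EReal.exp_eq_zero_iff,
    EReal.neg_eq_bot_iff] at hy'
  exact hEy hy'

theorem integrableOn_cube_of_continuous {f : Pt d → ℝ} (hf : Continuous f) (a : ℝ) :
    IntegrableOn f (cube d a) :=
  hf.continuousOn.integrableOn_compact
    (Metric.isCompact_of_isClosed_isBounded (isClosed_cube a) (bddBorel_cube a).1)

theorem integral_cube_coord (i : Fin d) : ∫ x in cube d 1, 2 * x i = 0 := by
  have h := integral_neg_eq_self ((cube d 1).indicator fun x : Pt d => 2 * x i) volume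
  have hneg : ∀ x : Pt d, (cube d 1).indicator (fun x : Pt d => 2 * x i) (-x) =
      -(cube d 1).indicator (fun x : Pt d => 2 * x i) x := by
    intro x
    have hmem : -x ∈ cube d 1 ↔ x ∈ cube d 1 :=
      forall_congr' fun j => by
        simp only [PiLp.neg_apply, Set.mem_Icc]
        constructor <;> rintro ⟨h1, h2⟩ <;> constructor <;> linarith
    by_cases hx : x ∈ cube d 1
    · rw [Set.indicator_of_mem hx, Set.indicator_of_mem (hmem.2 hx)]
      simp
    · rw [Set.indicator_of_notMem hx, Set.indicator_of_notMem (mt hmem.1 hx), neg_zero]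
  simp only [hneg, integral_neg] at h
  rw [← integral_indicator (bddBorel_cube 1).2]
  linarith

theorem integral_cube_cutoff_pos (i : Fin d) : 0 < ∫ x in cube d 1, (1 - x i ^ 2) := by
  have hcont : Continuous fun x : Pt d => 1 - x i ^ 2 :=
    continuous_const.sub ((EuclideanSpace.proj i).continuous.pow 2)
  rw [setIntegral_pos_iff_support_of_nonneg_ae _ (integrableOn_cube_of_continuous hcont 1)]
  · refine (Measure.measure_pos_of_mem_nhds volume
      (cube_mem_nhds (a := 1 / 2) (y := (0 : Pt d)) fun j => ?_)).trans_le (measure_mono ?_)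
    · simp
    · intro x hx
      refine ⟨?_, fun j => ⟨by linarith [(hx j).1], by linarith [(hx j).2]⟩⟩
      have h := hx i
      have : 0 < 1 - x i ^ 2 := by nlinarith [h.1, h.2]
      exact this.ne'
  · filter_upwards [ae_restrict_mem (bddBorel_cube 1).2] with x hx
    have h := hx i
    show 0 ≤ 1 - x i ^ 2
    nlinarith [h.1, h.2]

variable {P P₀ : Measure (Config d)}

theorem Config.insert_erase {ω : Config d} {x : Pt d} (hx : x ∈ ω.pts) :
    (ω.erase x).insert x = ω := by
  ext1
  exact Set.insert_sdiff_self_of_mem hx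

/-- For the reduced Campbell measure, adding the removed point almost surely gives a
configuration of locally finite energy. -/
theorem IsCanonicalGibbs.tsum_notMem_finiteEnergy (hP : IsCanonicalGibbs H P) (L : Set (Pt d)) :
    ∫⁻ ω, ∑' x : ω.pts, L.indicator (fun y =>
      {p : Pt d × Config d | p.2.insert p.1 ∉ finiteEnergy H}.indicator (1 : Pt d × Config d → ℝ≥0∞)
        (y, ω.erase y)) x ∂P = 0 := by
  refine lintegral_eq_zero_of_ae_eq_zero ?_
  filter_upwards [hP.ae_finiteEnergy] with ω hω
  refine ENNReal.tsum_eq_zero.2 fun x => ?_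
  refine Set.indicator_apply_eq_zero.2 fun _ => Set.indicator_of_notMem ?_ _
  simp only [Set.mem_ofPred_eq, not_not]
  rwa [Config.insert_erase x.2]

/-- The Campbell formula for the points in `L`. -/
theorem IsReducedPalm.campbell_eq_setLIntegral (hP₀ : IsReducedPalm P P₀) {L : Set (Pt d)}
    (hL : MeasurableSet L) {h : Pt d × Config d → ℝ≥0∞} (hh : Measurable h) :
    ∫⁻ ω, ∑' x : ω.pts, L.indicator (fun y => h (y, ω.erase y)) x ∂P =
      intensity P * ∫⁻ x in L, ∫⁻ ω, h (x, ω.shift x) ∂P₀ := by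
  have hm : Measurable (Function.uncurry fun x ω => (L ×ˢ Set.univ).indicator h (x, ω)) :=
    hh.indicator (hL.prod MeasurableSet.univ)
  have hc := hP₀.campbell_eq _ hm
  have h1 : ∀ (x : Pt d) (ω : Config d),
      (L ×ˢ Set.univ).indicator h (x, ω) = L.indicator (fun y => h (y, ω)) x := by
    intro x ω
    by_cases hx : x ∈ L <;> simp [hx]
  have h2 : ∀ (ω : Config d) (x : ω.pts), L.indicator (fun y => h (y, ω.erase x)) (x : Pt d) =
      L.indicator (fun y => h (y, ω.erase y)) x := by
    intro ω x
    by_cases hx : (x : Pt d) ∈ L <;> simp [hx]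
  have h3 : ∀ x : Pt d, ∫⁻ ω, L.indicator (fun y => h (y, ω.shift x)) x ∂P₀ =
      L.indicator (fun x => ∫⁻ ω, h (x, ω.shift x) ∂P₀) x := by
    intro x
    by_cases hx : x ∈ L <;> simp [hx]
  simp only [campbell, h1, h2, h3] at hc
  rw [hc, lintegral_indicator hL]

/-- The Palm integral of `A` is recovered from an integral over the cube with the cutoff
`1 - x_i²`: the derivative `-2 x_i` of the cutoff contributes nothing because it is odd, and the
cutoff itself has a positive integral. -/
theorem integral_eq_zero_of_integral_cutoff_eq_zero [IsProbabilityMeasure P₀] {A G : Config d → ℝ}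
    (hA : Integrable A P₀) (hG : Integrable G P₀) (i : Fin d)
    (h0 : ∫ q : Pt d × Config d, ((1 - q.1 i ^ 2) * A q.2 - 2 * q.1 i * G q.2)
      ∂((volume.restrict (cube d 1)).prod P₀) = 0) :
    ∫ ω, A ω ∂P₀ = 0 := by
  have hcont : Continuous fun x : Pt d => x i := (EuclideanSpace.proj i).continuous
  have h1 : IntegrableOn (fun x : Pt d => 1 - x i ^ 2) (cube d 1) :=
    integrableOn_cube_of_continuous (continuous_const.sub (hcont.pow 2)) 1
  have h2 : IntegrableOn (fun x : Pt d => 2 * x i) (cube d 1) :=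
    integrableOn_cube_of_continuous (continuous_const.mul hcont) 1
  have e1 := integral_prod_mul (μ := volume.restrict (cube d 1)) (ν := P₀)
    (fun x : Pt d => 1 - x i ^ 2) A
  have e2 := integral_prod_mul (μ := volume.restrict (cube d 1)) (ν := P₀)
    (fun x : Pt d => 2 * x i) G
  rw [integral_sub (h1.mul_prod hA) (h2.mul_prod hG), e1, e2, integral_cube_coord, zero_mul,
    sub_zero] at h0
  exact (mul_eq_zero.1 h0).resolve_left (integral_cube_cutoff_pos i).ne'

theorem measurable_recenter : Measurable fun p : Pt d × Config d => p.2.shift (-p.1) :=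
  measurable_shift.comp (measurable_fst.neg.prodMk measurable_snd)

/-- Conditionally on the environment `η` of a point `y` in the cube, the positive and negative parts
of the field `Φ` have the same integral: this is `integral_cube_eq_zero` for
`y ↦ g(y, η) e^{-H(η ∪ y)}`. -/
theorem lintegral_pos_eq_neg_of_environment (hH : IsEnergyFamily H)
    (hHdiff : IsAEDifferentiableFamily H) {g : Pt d → Config d → ℝ}
    (hg : IsShiftInvariantTest H g) (i : Fin d) {η : Config d} {Φ : Pt d → ℝ} (hΦ : Measurable Φ)
    (hpos : ∫⁻ y in cube d 1, ENNReal.ofReal (Φ y) *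
      EReal.exp (-(H (cube d 1) (η.insert y))) < ∞)
    (hneg : ∫⁻ y in cube d 1, ENNReal.ofReal (-Φ y) *
      EReal.exp (-(H (cube d 1) (η.insert y))) < ∞)
    (hfin : ∀ᵐ y ∂(volume.restrict (cube d 1)), H (cube d 1) (η.insert y) ≠ ⊤ →
      η.insert y ∈ finiteEnergy H)
    (hrep : ∀ᵐ y ∂(volume.restrict (cube d 1)), H (cube d 1) (η.insert y) ≠ ⊤ →
      Φ y = (1 - y i ^ 2) * (gradient (fun x => g x η) y i - g y η * gradH H y η i) -
        2 * y i * g y η) :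
    ∫⁻ y in cube d 1, ENNReal.ofReal (Φ y) * EReal.exp (-(H (cube d 1) (η.insert y))) =
      ∫⁻ y in cube d 1, ENNReal.ofReal (-Φ y) * EReal.exp (-(H (cube d 1) (η.insert y))) := by
  have hL := bddBorel_cube (d := d) 1
  have hw : Measurable fun y => EReal.exp (-(H (cube d 1) (η.insert y))) :=
    (measurable_exp_neg (hH.measurable _ hL)).comp
      (measurable_insert.comp measurable_prodMk_right)
  have hw_top : ∀ y, EReal.exp (-(H (cube d 1) (η.insert y))) ≠ ∞ := fun y => by
    rw [Ne, EReal.exp_eq_top_iff, EReal.neg_eq_top_iff]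
    exact hH.ne_bot _ hL _
  have hint := integrable_mul_toReal hΦ hw hw_top hpos hneg
  have hzero : ∫ y in cube d 1,
      Φ y * (EReal.exp (-(H (cube d 1) (η.insert y)))).toReal = 0 := by
    refine integral_cube_eq_zero (G := fun y => g y η)
      (E := fun y => H (cube d 1) (η.insert y)) i (fun y => hH.ne_bot _ hL _)
      (hg.regularizing η 1 one_pos i) ?_ hint
    filter_upwards [hHdiff η, hg.ae_differentiable η, (ae_restrict_iff' hL.2).1 hfin,
      (ae_restrict_iff' hL.2).1 hrep] with y hy hgy hfiny hrepy hmem hEy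
    have hyL : y ∈ cube d 1 := fun j => Set.Ioo_subset_Icc_self (hmem j)
    obtain ⟨hev, hgrad⟩ := hH.hasGradientAt_of_hasEnergyGradient hL (cube_mem_nhds hmem) hEy
      (hy.hasEnergyGradient_gradH (hfiny hyL hEy))
    exact ⟨_, _, hgy.hasGradientAt, hev, hgrad, hrepy hyL hEy⟩
  have h := lintegral_pos_eq_neg_of_integral_eq_zero hint hzero
  simpa only [← neg_mul, ofReal_mul_toReal (hw_top _)] using h

end PointProcess

open PointProcess
theorem proposition2 (d : ℕ) (hd : 1 ≤ d) (z : ℝ) (hz : 0 < z)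
    (H : Set (Pt d) → Config d → EReal)
    (hH : IsEnergyFamily H) (hHint : IsIntegrableFamily z H)
    (hHdiff : IsAEDifferentiableFamily H) (hHshift : IsShiftInvariantFamily H)
    (P P₀ : Measure (Config d)) (hP : IsCanonicalGibbs H P) (hPstat : IsStationaryLaw P)
    (hP_pos : 0 < intensity P) (hP_fin : intensity P < ∞) (hP₀ : IsReducedPalm P P₀)
    (g : Pt d → Config d → ℝ) (hg : IsShiftInvariantTest H g)
    (hg_grad : Integrable (fun ω => gradient (fun x => g x ω) 0) P₀)
    (hg_int : Integrable (fun ω => g 0 ω) P₀)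
    (hg_gradH : Integrable (fun ω => g 0 ω • gradH H 0 ω) P₀) :
    ∫ ω, gradient (fun x => g x ω) 0 ∂P₀ = ∫ ω, g 0 ω • gradH H 0 ω ∂P₀ := by
  have := hP₀.isProbabilityMeasure
  have hL := bddBorel_cube (d := d) 1
  obtain ⟨M, hM⟩ := hP.exists_campbell_disintegration hd hL (hH.measurable _ hL)
  have hMpalm : ∀ h : Pt d × Config d → ℝ≥0∞, Measurable h →
      ∫⁻ η, (∫⁻ y in cube d 1, h (y, η) * EReal.exp (-(H (cube d 1) (η.insert y)))) ∂M =
        intensity P * ∫⁻ x in cube d 1, ∫⁻ ω, h (x, ω.shift x) ∂P₀ := fun h hh => by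
    rw [← hM h hh, hP₀.campbell_eq_setLIntegral hL.2 hh]
  have hEm : Measurable fun p : Pt d × Config d => H (cube d 1) (p.2.insert p.1) :=
    (hH.measurable _ hL).comp measurable_insert
  -- Measurable versions of the two gradients, and a measurable null set outside of which they
  -- are versions.
  obtain ⟨F, hF, hFae⟩ := hg_grad.1
  obtain ⟨K, hK, hKae⟩ := hg_gradH.1
  have hFi := hg_grad.congr hFae
  have hKi := hg_gradH.congr hKae
  rw [integral_congr_ae hFae, integral_congr_ae hKae, ← sub_eq_zero, ← integral_sub hFi hKi]
  obtain ⟨N, hNsub, hNm, hN0⟩ := exists_measurable_superset_of_null (ae_iff.1 (hFae.and hKae))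
  have hN : ∀ ω, ω ∉ N → gradient (fun x => g x ω) 0 = F ω ∧ g 0 ω • gradH H 0 ω = K ω :=
    fun ω hω => by
      by_contra h
      exact hω (hNsub h)
  have hNgood : ∀ᵐ η ∂M, ∀ᵐ y ∂(volume.restrict (cube d 1)),
      H (cube d 1) (η.insert y) ≠ ⊤ → η.shift (-y) ∉ N := by
    refine ae_notMem_of_lintegral_eq_zero (B := (fun p => p.2.shift (-p.1)) ⁻¹' N) hEm
      (measurable_recenter hNm) ?_
    rw [hMpalm _ (measurable_one.indicator (measurable_recenter hNm))]
    have h0 : ∀ x : Pt d, ∫⁻ ω, ((fun p : Pt d × Config d => p.2.shift (-p.1)) ⁻¹' N).indicator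
        (1 : Pt d × Config d → ℝ≥0∞) (x, ω.shift x) ∂P₀ = 0 := by
      intro x
      have heq : ∀ ω : Config d, ((fun p : Pt d × Config d => p.2.shift (-p.1)) ⁻¹' N).indicator
          (1 : Pt d × Config d → ℝ≥0∞) (x, ω.shift x) = N.indicator 1 ω := by
        intro ω
        classical
        rw [Set.indicator_apply, Set.indicator_apply, Set.mem_preimage, Config.shift_neg_shift]
        rfl
      rw [lintegral_congr heq, lintegral_indicator_one hNm, hN0]
    simp only [h0, lintegral_zero, mul_zero]
  have hBm : MeasurableSet {p : Pt d × Config d | p.2.insert p.1 ∉ finiteEnergy H} :=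
    (measurable_insert hH.measurableSet_finiteEnergy).compl
  have hfin := ae_notMem_of_lintegral_eq_zero hEm hBm
    ((hM _ (measurable_one.indicator hBm)).symm.trans (hP.tsum_notMem_finiteEnergy (cube d 1)))
  have hAi := hFi.sub hKi
  suffices h : ∀ i : Fin d, ∫ ω, (F ω i - K ω i) ∂P₀ = 0 by
    ext i
    exact ((EuclideanSpace.proj i : Pt d →L[ℝ] ℝ).integral_comp_comm hAi).symm.trans (h i)
  intro i
  have hA : Integrable (fun ω => F ω i - K ω i) P₀ :=
    (EuclideanSpace.proj i : Pt d →L[ℝ] ℝ).integrable_comp hAi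
  have hAm : Measurable fun ω => F ω i - K ω i :=
    ((EuclideanSpace.proj i : Pt d →L[ℝ] ℝ).measurable.comp hF.measurable).sub
      ((EuclideanSpace.proj i : Pt d →L[ℝ] ℝ).measurable.comp hK.measurable)
  have hcm : Measurable fun p : Pt d × Config d => p.1 i :=
    (EuclideanSpace.proj i : Pt d →L[ℝ] ℝ).measurable.comp measurable_fst
  -- `Φ (y, η) e^{-H(η ∪ y)}` is a measurable version of `∂_i [(1 - y_i²) g(y, η) e^{-H(η ∪ y)}]`;
  -- `Ψ` is `Φ` with the environment seen from the point.
  set Φ : Pt d × Config d → ℝ := fun p =>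
    (1 - p.1 i ^ 2) * (F (p.2.shift (-p.1)) i - K (p.2.shift (-p.1)) i) -
      2 * p.1 i * g p.1 p.2 with hΦ
  have hΦm : Measurable Φ :=
    ((measurable_const.sub (hcm.pow_const 2)).mul (hAm.comp measurable_recenter)).sub
      ((measurable_const.mul hcm).mul hg.measurable)
  set Ψ : Pt d × Config d → ℝ := fun q =>
    (1 - q.1 i ^ 2) * (F q.2 i - K q.2 i) - 2 * q.1 i * g 0 q.2 with hΨ
  have hΦΨ : ∀ x ω, Φ (x, ω.shift x) = Ψ (x, ω) := fun x ω => by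
    have h := hg.shift_invariant x 0 ω
    rw [zero_add] at h
    simp only [hΦ, hΨ, Config.shift_neg_shift, h]
  have hΨm : Measurable Ψ := by
    have : Ψ = fun q => Φ (q.1, q.2.shift q.1) := funext fun q => (hΦΨ q.1 q.2).symm
    rw [this]
    exact hΦm.comp (measurable_fst.prodMk measurable_shift)
  have hΨi : Integrable Ψ ((volume.restrict (cube d 1)).prod P₀) := by
    have hcont : Continuous fun x : Pt d => x i := (EuclideanSpace.proj i).continuous
    exact ((integrableOn_cube_of_continuous (continuous_const.sub (hcont.pow 2)) 1).mul_prod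
      hA).sub ((integrableOn_cube_of_continuous (continuous_const.mul hcont) 1).mul_prod hg_int)
  -- Only `s = 1` and `s = -1` are needed, for the positive and the negative part.
  have hlin : ∀ s : ℝ, ∫⁻ η, (∫⁻ y in cube d 1, ENNReal.ofReal (s * Φ (y, η)) *
      EReal.exp (-(H (cube d 1) (η.insert y)))) ∂M = intensity P *
        ∫⁻ q, ENNReal.ofReal (s * Ψ q) ∂((volume.restrict (cube d 1)).prod P₀) := fun s => by
    rw [hMpalm (fun p => ENNReal.ofReal (s * Φ p)) (hΦm.const_mul s).ennreal_ofReal,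
      lintegral_prod _ (hΨm.const_mul s).ennreal_ofReal.aemeasurable]
    simp only [hΦΨ]
  have hlt : ∀ s : ℝ, ∀ᵐ η ∂M, ∫⁻ y in cube d 1, ENNReal.ofReal (s * Φ (y, η)) *
      EReal.exp (-(H (cube d 1) (η.insert y))) < ∞ := fun s => by
    refine ae_lt_top ?_ ?_
    · exact ((hΦm.const_mul s).ennreal_ofReal.mul
        (EReal.measurable_exp.comp hEm.neg)).lintegral_prod_left'
    · rw [hlin]
      exact (ENNReal.mul_lt_top hP_fin (hΨi.const_mul s).lintegral_lt_top).ne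
  have henv : ∀ᵐ η ∂M, ∫⁻ y in cube d 1, ENNReal.ofReal (1 * Φ (y, η)) *
      EReal.exp (-(H (cube d 1) (η.insert y))) =
        ∫⁻ y in cube d 1, ENNReal.ofReal (-1 * Φ (y, η)) *
          EReal.exp (-(H (cube d 1) (η.insert y))) := by
    filter_upwards [hlt 1, hlt (-1), hNgood, hfin] with η hpos hneg hNη hfinη
    simp only [one_mul, neg_one_mul] at hpos hneg ⊢
    refine lintegral_pos_eq_neg_of_environment hH hHdiff hg i
      (hΦm.comp measurable_prodMk_right) hpos hneg ?_ ?_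
    · filter_upwards [hfinη] with y hy hEy
      exact not_not.1 (hy hEy)
    · filter_upwards [hNη] with y hy hEy
      obtain ⟨h1, h2⟩ := hN _ (hy hEy)
      have h3 := gradient_shift hg.shift_invariant (-y) y η
      have h4 := hHshift.gradH_shift (-y) y η
      have h5 := hg.shift_invariant (-y) y η
      rw [add_neg_cancel] at h3 h4 h5
      simp only [hΦ, ← h1, ← h2, h3, h4, h5, PiLp.smul_apply, smul_eq_mul]
  refine integral_eq_zero_of_integral_cutoff_eq_zero hA hg_int i ?_
  have hparts := lintegral_congr_ae henv
  rw [hlin, hlin, ENNReal.mul_right_inj hP_pos.ne' hP_fin.ne] at hparts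
  simp only [one_mul, neg_one_mul] at hparts
  rw [integral_eq_lintegral_pos_part_sub_lintegral_neg_part hΨi, hparts, sub_self]
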